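/- \textbf{Setting.} A closed 3-manifold triangulation of size $n$ is a collection of $n$ tetrahedra whose $4n$ faces are affinely identified in $2n$ pairs (two faces of the same tetrahedron may be identified with each other) such that the resulting quotient space is a connected 3-manifold without boundary. In each tetrahedron there are four types of normal triangle (one around each vertex) and three types of normal quadrilateral (one for each way of separating the four vertices into two pairs); this gives $7n$ coordinates in all. For a glued face and a vertex $v$ of that face, the corresponding matching equation says that the sum of the triangle coordinate and the quadrilateral coordinate whose discs meet the face in arcs cutting off $v$ is the same on both sides of the gluing. The projective solution space is the polytope of all $x\in\mathbb{R}^{7n}$ with $x\ge 0$ and $\sum_i x_i=1$ that satisfy all matching equations. A vertex of this polytope is admissible if in each tetrahedron at most one of its three quadrilateral coordinates is non-zero. The admissible vertex count $\sigma(\mathcal{T})$ of a triangulation $\mathcal{T}$ is the number of admissible vertices of its projective solution space. \textbf{Corollary.} Let $f:\mathbb{N}\to\mathbb{R}$ be any upper bound for the admissible vertex count, that is, $\sigma(\mathcal{T})\le f(n)$ for every $n$ and every closed 3-manifold triangulation $\mathcal{T}$ of size $n$. Then $f(n)\in\Omega(17^{n/4})$: there are $c>0$ and $N$ such that $f(n)\ge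 c\cdot 17^{n/4}$ for all $n\ge N$. Here $17^{1/4}\simeq 2.03$ to two decimal places, i.e. $|17^{1/4}-2.03|<0.005$. In particular $\sigma\notin O(2^n)$: there are no constants $C\in\mathbb{R}$ and $N\in\mathbb{N}$ such that $\sigma(\mathcal{T})\le C\cdot 2^n$ for every $n\ge N$ and every closed 3-manifold triangulation $\mathcal{T}$ of size $n$. -/

import Mathlib

namespace NormalSurface

/-- A combinatorial gluing of `n` tetrahedra `0, …, n-1`, each with vertices `0, 1, 2, 3`, in which
all `4n` faces are affinely identified in `2n` pairs. Face `f` of a tetrahedron is the one opposite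
to its vertex `f`. Face `f` of tetrahedron `t` is glued to face `glue t f f` of tetrahedron
`adj t f`, each vertex `v ≠ f` of the face being sent to the vertex `glue t f v`. -/
structure Gluing (n : ℕ) where
  adj : Fin n → Fin 4 → Fin n
  glue : Fin n → Fin 4 → Equiv.Perm (Fin 4)
  adj_adj : ∀ t f, adj (adj t f) (glue t f f) = t
  glue_glue : ∀ t f, glue (adj t f) (glue t f f) = (glue t f)⁻¹
  ne_self : ∀ t f, (adj t f, glue t f f) ≠ (t, f)

namespace Gluing

variable {n : ℕ}

/-- The elementary identification of points of `n` disjoint tetrahedra: the point `p`, on face `f`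
of its tetrahedron, is identified with its image `q` under the affine gluing map of that face.
Points of a tetrahedron are given by their barycentric coordinates. -/
def Identified (T : Gluing n) (p q : Fin n × stdSimplex ℝ (Fin 4)) : Prop :=
  ∃ f : Fin 4, p.2.1 f = 0 ∧ q.1 = T.adj p.1 f ∧ ∀ v, q.2.1 (T.glue p.1 f v) = p.2.1 v

/-- The topological space obtained from `n` disjoint tetrahedra by the face gluings, with the
quotient topology (of the equivalence relation generated by the elementary identifications). -/
def Space (T : Gluing n) : Type := Quot T.Identified

instance (T : Gluing n) : TopologicalSpace T.Space :=
  inferInstanceAs (TopologicalSpace (Quot T.Identified))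

/-- `T` is a closed 3-manifold triangulation: its space is a connected topological 3-manifold
without boundary (it is automatically compact). -/
structure IsClosedThreeManifold (T : Gluing n) : Prop where
  connected : ConnectedSpace T.Space
  hausdorff : T2Space T.Space
  secondCountable : SecondCountableTopology T.Space
  locallyEuclidean : ∀ x : T.Space,
    ∃ e : OpenPartialHomeomorph T.Space (EuclideanSpace ℝ (Fin 3)), x ∈ e.source

end Gluing

/-- The type of the quadrilaterals of a tetrahedron that have the distinct vertices `a` and `b` on
the same side (and hence the other two vertices on the other side). The types `0`, `1`, `2`
separate the vertices as `01|23`, `02|13`, `03|12` respectively. The value for `a = b` is never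
used. -/
def quadType (a b : Fin 4) : Fin 3 :=
  (![![0, 0, 1, 2], ![0, 0, 2, 1], ![1, 2, 0, 0], ![2, 1, 0, 0]] : Fin 4 → Fin 4 → Fin 3) a b

/-- The coordinates of `ℝ^{7n}`: in each tetrahedron `t` there are the four triangle types
`(t, Sum.inl v)` (triangles cutting off the vertex `v`) and the three quadrilateral types
`(t, Sum.inr i)`. -/
abbrev DiscType (n : ℕ) : Type := Fin n × (Fin 4 ⊕ Fin 3)

variable {n : ℕ}

/-- For `v ≠ f`, the number of arcs on face `f` of tetrahedron `t` that cut off the vertex `v` of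
this face: they come from the triangles around `v`, and from the quadrilaterals that have `v` and
`f` on the same side. -/
def arcs (x : DiscType n → ℝ) (t : Fin n) (f v : Fin 4) : ℝ :=
  x (t, Sum.inl v) + x (t, Sum.inr (quadType v f))

/-- The matching equations: arcs on the two sides of every glued face agree. -/
def Matching (T : Gluing n) (x : DiscType n → ℝ) : Prop :=
  ∀ (t : Fin n) (f v : Fin 4), v ≠ f →
    arcs x t f v = arcs x (T.adj t f) (T.glue t f f) (T.glue t f v)

/-- The quadrilateral constraints: at most one quadrilateral coordinate is non-zero in each
tetrahedron. -/
def QuadConstraints (x : DiscType n → ℝ) : Prop :=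
  ∀ (t : Fin n) (i j : Fin 3), x (t, Sum.inr i) ≠ 0 → x (t, Sum.inr j) ≠ 0 → i = j

/-- The projective solution space: the cross-section, by the hyperplane on which the coordinates
sum to `1`, of the cone of non-negative solutions of the matching equations. -/
def projectiveSolutionSpace (T : Gluing n) : Set (DiscType n → ℝ) :=
  {x | (∀ d, 0 ≤ x d) ∧ Matching T x ∧ ∑ d, x d = 1}

/-- The admissible vertices: the vertices of the projective solution space that satisfy the
quadrilateral constraints. -/
def admissibleVertices (T : Gluing n) : Set (DiscType n → ℝ) :=
  {x | x ∈ Set.extremePoints ℝ (projectiveSolutionSpace T) ∧ QuadConstraints x}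

/-- The matching equations are preserved by affine combinations. -/
theorem Matching.combine {T : Gluing n} {x y : DiscType n → ℝ} (hx : Matching T x)
    (hy : Matching T y) (a b : ℝ) : Matching T (fun d => a * x d + b * y d) := by
  intro t f v hv
  have h1 := hx t f v hv
  have h2 := hy t f v hv
  simp only [arcs] at *
  linear_combination a * h1 + b * h2

/-- There are only finitely many admissible vertices: a vertex is determined by its support. -/
theorem admissibleVertices_finite (T : Gluing n) : (admissibleVertices T).Finite := by
  classical
  refine Set.Finite.of_injOn (f := fun x : DiscType n → ℝ => {d | x d ≠ 0})
    (t := Set.univ) (fun _ _ => Set.mem_univ _) ?_ Set.finite_univ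
  rintro x ⟨hx, -⟩ y ⟨hy, -⟩ hxy
  have hsupp : ∀ d, x d = 0 → y d = 0 := by
    intro d hd
    by_contra h
    have : d ∈ {d | x d ≠ 0} := by
      have h' : d ∈ {d | y d ≠ 0} := h
      simpa only [hxy] using h'
    exact this hd
  obtain ⟨⟨hx0, hxm, hxs⟩, hext⟩ := hx
  obtain ⟨hy0, hym, hys⟩ := hy.1
  -- a small step from `x` away from `y` stays inside the polytope
  obtain ⟨ε, hε, hεd⟩ : ∃ ε : ℝ, 0 < ε ∧ ∀ d, ε * y d ≤ x d := by
    have key : ∀ s : Finset (DiscType n), ∃ ε : ℝ, 0 < ε ∧ ∀ d ∈ s, ε * y d ≤ x d := by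
      intro s
      induction s using Finset.induction_on with
      | empty => exact ⟨1, one_pos, by simp⟩
      | insert a s _ ih =>
        obtain ⟨ε, hε, h⟩ := ih
        obtain ⟨δ, hδ, hδa⟩ : ∃ δ : ℝ, 0 < δ ∧ δ * y a ≤ x a := by
          rcases (hx0 a).eq_or_lt with h0 | h0
          · exact ⟨1, one_pos, by rw [hsupp a h0.symm, ← h0]; simp⟩
          · refine ⟨x a / (y a + 1), by have := hy0 a; positivity, ?_⟩
            have := hy0 a
            rw [div_mul_eq_mul_div, div_le_iff₀ (by positivity)]
            nlinarith
        refine ⟨min ε δ, lt_min hε hδ, ?_⟩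
        intro d hd
        rcases Finset.mem_insert.1 hd with rfl | hd
        · exact (mul_le_mul_of_nonneg_right (min_le_right _ _) (hy0 _)).trans hδa
        · exact (mul_le_mul_of_nonneg_right (min_le_left _ _) (hy0 _)).trans (h d hd)
    obtain ⟨ε, hε, h⟩ := key Finset.univ
    exact ⟨ε, hε, fun d => h d (Finset.mem_univ d)⟩
  have hz : (fun d => (1 + ε) * x d + (-ε) * y d) ∈ projectiveSolutionSpace T := by
    refine ⟨fun d => ?_, hxm.combine hym _ _, ?_⟩
    · have := hεd d
      have := mul_nonneg hε.le (hx0 d)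
      dsimp only
      linarith
    · rw [Finset.sum_add_distrib, ← Finset.mul_sum, ← Finset.mul_sum, hxs, hys]
      ring
  have hseg : x ∈ openSegment ℝ (fun d => (1 + ε) * x d + (-ε) * y d) y := by
    refine ⟨1 / (1 + ε), ε / (1 + ε), by positivity, by positivity, by field_simp, ?_⟩
    funext d
    simp only [Pi.add_apply, Pi.smul_apply, smul_eq_mul]
    field_simp
    ring
  have := hext hz ⟨hy0, hym, hys⟩ hseg
  funext d
  have hd := congrFun this d
  have : ε * (x d - y d) = 0 := by linarith
  rcases mul_eq_zero.1 this with h | h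
  · exact absurd h hε.ne'
  · linarith

/-- The admissible vertex count `σ` of a triangulation. -/
noncomputable def sigma (T : Gluing n) : ℕ := (admissibleVertices T).ncard

end NormalSurface

/-! Many vertices come from a ring of small balls in which normal surfaces can be chosen
independently. Each ball has two free triangular faces, its ports. The balls are glued in series,
port to port, and finally the last port is glued to the first. Two balls are used: `snapped`, one
tetrahedron with two faces folded together, and `block`, made of four tetrahedra. In `block` there
are seventeen admissible normal surfaces (`blockRay`) with exactly one arc around each vertex of
each port. Any choice of one of them in every block, completed by `snappedRay` in the snapped balls,
therefore fits together around the ring. With `r + 1` snapped balls and `k + 1` blocks this gives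
`17 ^ (k + 1)` surfaces on `r + 1 + 4 * (k + 1)` tetrahedra; the snapped balls absorb the residue of
the size modulo 4.

Each such surface, normalized, is a vertex because its support determines it up to a factor
(`mem_admissibleVertices_of_unique`). Inside a block this is linear algebra (`blockRay_unique`),
provided that each port carries equally many arcs around its three vertices. The folds supply these
equalities: in either ball the fold next to the second port makes the counts at `0` and `1` agree
(`isFolded_snapped`, `isFolded_block`), and the fold next to the first port of a block makes those
at `0` and `2` agree (`portArc_block_false`). On the last port the second equality is obtained by
going round the ring: the chain of snapped balls carries the equalities at its far end back to its
first port (`IsParallel.isTight_glue_block`). `IsRay.glue` then propagates proportionality backwards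
from ball to ball.

The ring is a 3-sphere. Both `snapped.glue snapped` and `snapped.glue block` are homeomorphic to
`snapped` compatibly with the ports, so a chain that begins with a snapped ball is homeomorphic to a
single one. Closing up one snapped tetrahedron gives the join of two circles
(`close_snapped_homeo`). The homeomorphisms are compositions of Pachner moves, each realized by a
common stellar subdivision: the geometry is done once (`IsStellar.portHomeo`), and the combinatorics
of each move is decided by computation. -/

namespace NormalSurface

open Equiv

/-! ### Complexes with two ports: glued spaces, gluing in series and closing up -/

/-- The standard tetrahedron, in barycentric coordinates. -/
abbrev Tet : Type := stdSimplex ℝ (Fin 4)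

namespace Tet

/-- The relabelling of the vertices of the standard tetrahedron by a permutation. -/
def permute (a : Perm (Fin 4)) (p : Tet) : Tet :=
  ⟨fun v => p.1 (a⁻¹ v), fun v => p.2.1 _, by
    rw [← p.2.2]; exact Equiv.sum_comp (a⁻¹ : Perm (Fin 4)) p.1⟩

@[simp] theorem permute_val (a : Perm (Fin 4)) (p : Tet) (v : Fin 4) :
    (permute a p).1 v = p.1 (a⁻¹ v) := rfl

theorem permute_mul (a b : Perm (Fin 4)) (p : Tet) :
    permute (a * b) p = permute a (permute b p) := by
  rfl

@[simp] theorem permute_one (p : Tet) : permute 1 p = p := by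
  rfl

@[simp] theorem permute_inv_permute (a : Perm (Fin 4)) (p : Tet) :
    permute a⁻¹ (permute a p) = p := by
  rw [← permute_mul]; simp

@[simp] theorem permute_permute_inv (a : Perm (Fin 4)) (p : Tet) :
    permute a (permute a⁻¹ p) = p := by
  rw [← permute_mul]; simp

theorem continuous_permute (a : Perm (Fin 4)) : Continuous (permute a) := by
  refine Continuous.subtype_mk (continuous_pi fun v => ?_) _
  exact (continuous_apply (a⁻¹ v)).comp continuous_subtype_val

end Tet

/-- A gluing of tetrahedra indexed by `ι` with two boundary faces, called ports. Face `f` of the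
tetrahedron `t` is either glued to another face, or it is a port; in the latter case its vertices
are labelled by `0, 1, 2`, and the vertex `f` opposite to it is labelled by `3`. -/
structure PortedComplex (ι : Type) where
  adj : ι → Fin 4 → (ι × Perm (Fin 4)) ⊕ (Bool × Perm (Fin 4))
  port : Bool → ι × Perm (Fin 4)

namespace PortedComplex

variable {ι κ μ : Type}

/-- The elementary identification of points of the tetrahedra. -/
def Identified (K : PortedComplex ι) (p q : ι × Tet) : Prop :=
  ∃ f g, K.adj p.1 f = Sum.inl (q.1, g) ∧ p.2.1 f = 0 ∧ q.2 = Tet.permute g p.2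

/-- The topological space obtained from the tetrahedra by the face gluings. -/
def Space (K : PortedComplex ι) : Type := Quot K.Identified

/-- The point of the glued space given by a point of a tetrahedron. -/
def pt (K : PortedComplex ι) (t : ι) (p : Tet) : K.Space := Quot.mk _ (t, p)

instance [TopologicalSpace ι] (K : PortedComplex ι) : TopologicalSpace K.Space :=
  inferInstanceAs (TopologicalSpace (Quot K.Identified))

theorem pt_eq_pt (K : PortedComplex ι) {t t' : ι} {f : Fin 4} {g : Perm (Fin 4)}
    (h : K.adj t f = Sum.inl (t', g)) {p : Tet} (hp : p.1 f = 0) :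
    K.pt t p = K.pt t' (Tet.permute g p) :=
  Quot.sound ⟨f, g, h, hp, rfl⟩

theorem continuous_pt [TopologicalSpace ι] (K : PortedComplex ι) (t : ι) :
    Continuous (K.pt t) :=
  (continuous_quot_mk (r := K.Identified)).comp (by fun_prop : Continuous fun p : Tet => (t, p))

/-- A map out of the glued space is given by compatible maps of the tetrahedra. -/
def lift {X : Type*} (K : PortedComplex ι) (φ : ι → Tet → X)
    (h : ∀ t f t' g, K.adj t f = Sum.inl (t', g) → ∀ p : Tet, p.1 f = 0 →
      φ t p = φ t' (Tet.permute g p)) : K.Space → X :=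
  Quot.lift (fun x => φ x.1 x.2) (by
    rintro ⟨t, p⟩ ⟨t', q⟩ ⟨f, g, hadj, hp, hq⟩
    dsimp only at hadj hp hq ⊢
    subst hq
    exact h t f t' g hadj p hp)

theorem continuous_lift {X : Type*} [TopologicalSpace X] [TopologicalSpace ι]
    [DiscreteTopology ι] (K : PortedComplex ι) (φ : ι → Tet → X) (h)
    (hφ : ∀ t, Continuous (φ t)) : Continuous (K.lift φ h) :=
  continuous_quot_lift _ (continuous_prod_of_discrete_left.2 hφ)

theorem ind (K : PortedComplex ι) {P : K.Space → Prop} (h : ∀ t p, P (K.pt t p)) (x : K.Space) :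
    P x :=
  Quot.ind (fun y => h y.1 y.2) x

/-- A point of a port, as a point of the glued space. It matters only for `x 3 = 0`. -/
def portPoint (K : PortedComplex ι) (k : Bool) (x : Tet) : K.Space :=
  K.pt (K.port k).1 (Tet.permute (K.port k).2 x)

/-- The ports are the faces that are not glued. -/
def PortLaw (K : PortedComplex ι) : Prop :=
  (∀ t f k π, K.adj t f = Sum.inr (k, π) → π f = 3 ∧ K.port k = (t, π⁻¹)) ∧
  ∀ k, K.adj (K.port k).1 ((K.port k).2 3) = Sum.inr (k, (K.port k).2⁻¹)

theorem pt_eq_portPoint {K : PortedComplex ι} (hK : K.PortLaw) {t : ι} {f : Fin 4} {k : Bool}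
    {π : Perm (Fin 4)} (h : K.adj t f = Sum.inr (k, π)) (p : Tet) :
    K.pt t p = K.portPoint k (Tet.permute π p) := by
  obtain ⟨-, h2⟩ := hK.1 t f k π h
  simp [portPoint, h2]

theorem permute_port_eq_zero {K : PortedComplex ι} (hK : K.PortLaw) {t : ι} {f : Fin 4} {k : Bool}
    {π : Perm (Fin 4)} (h : K.adj t f = Sum.inr (k, π)) {p : Tet} (hp : p.1 f = 0) :
    (Tet.permute π p).1 3 = 0 := by
  obtain ⟨h1, -⟩ := hK.1 t f k π h
  rw [Tet.permute_val, ← h1]; simpa using hp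

/-- Homeomorphy of the glued spaces relative to the ports. -/
def PortHomeo [TopologicalSpace ι] [TopologicalSpace κ] (K : PortedComplex ι)
    (L : PortedComplex κ) : Prop :=
  ∃ h : K.Space ≃ₜ L.Space, ∀ k x, x.1 3 = 0 → h (K.portPoint k x) = L.portPoint k x

theorem PortHomeo.refl [TopologicalSpace ι] (K : PortedComplex ι) : PortHomeo K K :=
  ⟨Homeomorph.refl _, fun _ _ _ => rfl⟩

theorem PortHomeo.symm [TopologicalSpace ι] [TopologicalSpace κ] {K : PortedComplex ι}
    {L : PortedComplex κ} (h : PortHomeo K L) : PortHomeo L K := by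
  obtain ⟨e, he⟩ := h
  exact ⟨e.symm, fun k x hx => by rw [← he k x hx, e.symm_apply_apply]⟩

theorem PortHomeo.trans [TopologicalSpace ι] [TopologicalSpace κ] [TopologicalSpace μ]
    {K : PortedComplex ι} {L : PortedComplex κ} {M : PortedComplex μ} (h : PortHomeo K L)
    (h' : PortHomeo L M) : PortHomeo K M := by
  obtain ⟨e, he⟩ := h
  obtain ⟨e', he'⟩ := h'
  exact ⟨e.trans e', fun k x hx => by
    rw [Homeomorph.trans_apply, he k x hx, he' k x hx]⟩

/-- The complex obtained by gluing the second port of `K` to the first port of `L`. -/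
def glue (K : PortedComplex ι) (L : PortedComplex κ) : PortedComplex (ι ⊕ κ) where
  adj
    | Sum.inl t, f => match K.adj t f with
      | Sum.inl (t', g) => Sum.inl (Sum.inl t', g)
      | Sum.inr (false, π) => Sum.inr (false, π)
      | Sum.inr (true, π) => Sum.inl (Sum.inr (L.port false).1, (L.port false).2 * π)
    | Sum.inr t, f => match L.adj t f with
      | Sum.inl (t', g) => Sum.inl (Sum.inr t', g)
      | Sum.inr (true, π) => Sum.inr (true, π)
      | Sum.inr (false, π) => Sum.inl (Sum.inl (K.port true).1, (K.port true).2 * π)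
  port
    | false => (Sum.inl (K.port false).1, (K.port false).2)
    | true => (Sum.inr (L.port true).1, (L.port true).2)

/-- The complex obtained by gluing the two ports of `K` to each other. -/
def close (K : PortedComplex ι) : PortedComplex ι where
  adj t f := match K.adj t f with
    | Sum.inl x => Sum.inl x
    | Sum.inr (k, π) => Sum.inl ((K.port (!k)).1, (K.port (!k)).2 * π)
  port := K.port

theorem glue_portLaw {K : PortedComplex ι} {L : PortedComplex κ} (hK : K.PortLaw)
    (hL : L.PortLaw) : (K.glue L).PortLaw := by
  constructor
  · rintro (t | t) f k π h
    · rcases hadj : K.adj t f with ⟨t', g⟩ | ⟨_ | _, ρ⟩ <;> simp [glue, hadj] at h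
      obtain ⟨rfl, rfl⟩ := h
      obtain ⟨h1, h2⟩ := hK.1 _ _ _ _ hadj
      exact ⟨h1, by simp [glue, h2]⟩
    · rcases hadj : L.adj t f with ⟨t', g⟩ | ⟨_ | _, ρ⟩ <;> simp [glue, hadj] at h
      obtain ⟨rfl, rfl⟩ := h
      obtain ⟨h1, h2⟩ := hL.1 _ _ _ _ hadj
      exact ⟨h1, by simp [glue, h2]⟩
  · rintro (_ | _)
    · simp [glue, hK.2 false]
    · simp [glue, hL.2 true]

theorem inl_sound (K : PortedComplex ι) (L : PortedComplex κ) (t : ι) (f : Fin 4) (t' : ι)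
    (g : Perm (Fin 4)) (h : K.adj t f = Sum.inl (t', g)) (p : Tet) (hp : p.1 f = 0) :
    (K.glue L).pt (Sum.inl t) p = (K.glue L).pt (Sum.inl t') (Tet.permute g p) :=
  pt_eq_pt _ (by simp [glue, h]) hp

/-- The map of the first part of a glued complex. -/
def inlMap (K : PortedComplex ι) (L : PortedComplex κ) : K.Space → (K.glue L).Space :=
  K.lift (fun t p => (K.glue L).pt (Sum.inl t) p) (inl_sound K L)

/-- The two parts share the seam, so a point of the second port of `K` may be rewritten as a point
of `L`. This is how the compatibility checks in `glueMap` cross the seam. -/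
theorem port_glue {K : PortedComplex ι} {L : PortedComplex κ} (hK : K.PortLaw) {x : Tet}
    (hx : x.1 3 = 0) : inlMap K L (K.portPoint true x) =
      (K.glue L).pt (Sum.inr (L.port false).1) (Tet.permute (L.port false).2 x) := by
  have h := pt_eq_pt (K.glue L) (t := Sum.inl (K.port true).1) (f := (K.port true).2 3)
    (t' := Sum.inr (L.port false).1) (g := (L.port false).2 * (K.port true).2⁻¹)
    (p := Tet.permute (K.port true).2 x) (by simp [glue, hK.2 true]) (by simpa using hx)
  rw [Tet.permute_mul, Tet.permute_inv_permute] at h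
  exact h

/-- The map of glued complexes induced by a map of the first part that respects the ports. -/
def glueMap {K : PortedComplex ι} {K' : PortedComplex κ} (L : PortedComplex μ) (hK : K.PortLaw)
    (hK' : K'.PortLaw) (hL : L.PortLaw) (h : K.Space → K'.Space)
    (hport : ∀ k x, x.1 3 = 0 → h (K.portPoint k x) = K'.portPoint k x) :
    (K.glue L).Space → (K'.glue L).Space :=
  (K.glue L).lift (fun t p => match t with
    | Sum.inl t => inlMap K' L (h (K.pt t p))
    | Sum.inr t => (K'.glue L).pt (Sum.inr t) p) (by
    rintro (t | t) f (t' | t') g hadj p hp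
    · rcases hK0 : K.adj t f with ⟨t'', g'⟩ | ⟨_ | _, ρ⟩ <;> simp [glue, hK0] at hadj
      obtain ⟨rfl, rfl⟩ := hadj
      simp only
      rw [K.pt_eq_pt hK0 hp]
    · rcases hK0 : K.adj t f with ⟨t'', g'⟩ | ⟨_ | _, ρ⟩ <;> simp [glue, hK0] at hadj
      obtain ⟨rfl, rfl⟩ := hadj
      simp only
      have hx := permute_port_eq_zero hK hK0 hp
      rw [pt_eq_portPoint hK hK0, hport _ _ hx, port_glue hK' hx, Tet.permute_mul]
    · rcases hL0 : L.adj t f with ⟨t'', g'⟩ | ⟨_ | _, ρ⟩ <;> simp [glue, hL0] at hadj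
      obtain ⟨rfl, rfl⟩ := hadj
      simp only
      have hx := permute_port_eq_zero hL hL0 hp
      obtain ⟨h1, h2⟩ := hL.1 _ _ _ _ hL0
      have := hport true _ hx
      rw [Tet.permute_mul]
      change _ = inlMap K' L (h (K.portPoint true (Tet.permute ρ p)))
      rw [this, port_glue hK' hx, h2]
      simp
    · rcases hL0 : L.adj t f with ⟨t'', g'⟩ | ⟨_ | _, ρ⟩ <;> simp [glue, hL0] at hadj
      obtain ⟨rfl, rfl⟩ := hadj
      exact pt_eq_pt _ (by simp [glue, hL0]) hp)

theorem continuous_inlMap [TopologicalSpace ι] [DiscreteTopology ι] [TopologicalSpace κ]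
    (K : PortedComplex ι) (L : PortedComplex κ) : Continuous (inlMap K L) :=
  continuous_lift _ _ _ fun t => continuous_pt _ (Sum.inl t)

theorem continuous_glueMap [TopologicalSpace ι] [DiscreteTopology ι] [TopologicalSpace κ]
    [DiscreteTopology κ] [TopologicalSpace μ] [DiscreteTopology μ]
    {K : PortedComplex ι} {K' : PortedComplex κ} (L : PortedComplex μ) (hK : K.PortLaw)
    (hK' : K'.PortLaw) (hL : L.PortLaw) (h : K.Space → K'.Space) (hport) (hc : Continuous h) :
    Continuous (glueMap L hK hK' hL h hport) := by
  refine continuous_lift _ _ _ ?_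
  rintro (t | t)
  · exact (continuous_inlMap K' L).comp (hc.comp (continuous_pt K t))
  · exact continuous_pt _ _

theorem glueMap_inlMap {K : PortedComplex ι} {K' : PortedComplex κ} (L : PortedComplex μ)
    (hK : K.PortLaw) (hK' : K'.PortLaw) (hL : L.PortLaw) (h : K.Space → K'.Space) (hport)
    (x : K.Space) : glueMap L hK hK' hL h hport (inlMap K L x) = inlMap K' L (h x) := by
  induction x using K.ind with
  | h t p => rfl

theorem glueMap_comp {K : PortedComplex ι} {K' : PortedComplex κ} (L : PortedComplex μ)
    (hK : K.PortLaw) (hK' : K'.PortLaw) (hL : L.PortLaw) (h : K.Space → K'.Space) (hport)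
    (h' : K'.Space → K.Space) (hport') (hinv : ∀ x, h' (h x) = x) (x : (K.glue L).Space) :
    glueMap L hK' hK hL h' hport' (glueMap L hK hK' hL h hport x) = x := by
  induction x using (K.glue L).ind with
  | h t p =>
    rcases t with t | t
    · change glueMap L hK' hK hL h' hport' (inlMap K' L (h (K.pt t p))) = _
      rw [glueMap_inlMap, hinv]
      rfl
    · rfl

/-- Gluing respects homeomorphy relative to the ports. -/
theorem PortHomeo.glue [TopologicalSpace ι] [DiscreteTopology ι] [TopologicalSpace κ]
    [DiscreteTopology κ] [TopologicalSpace μ] [DiscreteTopology μ]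
    {K : PortedComplex ι} {K' : PortedComplex κ} (h : PortHomeo K K') (L : PortedComplex μ)
    (hK : K.PortLaw) (hK' : K'.PortLaw) (hL : L.PortLaw) :
    PortHomeo (K.glue L) (K'.glue L) := by
  obtain ⟨e, he⟩ := h
  have he' : ∀ k x, x.1 3 = 0 → e.symm (K'.portPoint k x) = K.portPoint k x :=
    fun k x hx => by rw [← he k x hx, e.symm_apply_apply]
  refine ⟨⟨⟨glueMap L hK hK' hL e he, glueMap L hK' hK hL e.symm he',
    glueMap_comp L hK hK' hL e he e.symm he' e.symm_apply_apply,
    glueMap_comp L hK' hK hL e.symm he' e he e.apply_symm_apply⟩,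
    continuous_glueMap L hK hK' hL e he e.continuous,
    continuous_glueMap L hK' hK hL e.symm he' e.symm.continuous⟩, ?_⟩
  rintro (_ | _) x hx
  · change inlMap K' L (e (K.portPoint false x)) = _
    rw [he false x hx]
    rfl
  · rfl

/-- The map of closed complexes induced by a map that respects the ports. -/
def closeMap {K : PortedComplex ι} {K' : PortedComplex κ} (hK : K.PortLaw)
    (hK' : K'.PortLaw) (h : K.Space → K'.Space)
    (hport : ∀ k x, x.1 3 = 0 → h (K.portPoint k x) = K'.portPoint k x) :
    K.close.Space → K'.close.Space :=
  K.close.lift (fun t p => (K'.lift (fun t p => K'.close.pt t p) (fun t f t' g hadj p hp =>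
      pt_eq_pt _ (by simp [close, hadj]) hp)) (h (K.pt t p))) (by
    intro t f t' g hadj p hp
    rcases hK0 : K.adj t f with ⟨t'', g'⟩ | ⟨k, ρ⟩ <;> simp [close, hK0] at hadj
    · obtain ⟨rfl, rfl⟩ := hadj
      rw [K.pt_eq_pt hK0 hp]
    · obtain ⟨rfl, rfl⟩ := hadj
      have hx := permute_port_eq_zero hK hK0 hp
      rw [pt_eq_portPoint hK hK0, hport _ _ hx, Tet.permute_mul]
      change _ = K'.lift _ _ (h (K.portPoint (!k) (Tet.permute ρ p)))
      rw [hport _ _ hx]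
      have := pt_eq_pt K'.close (t := (K'.port k).1) (f := (K'.port k).2 3)
        (t' := (K'.port (!k)).1) (g := (K'.port (!k)).2 * (K'.port k).2⁻¹)
        (p := Tet.permute (K'.port k).2 (Tet.permute ρ p)) (by simp [close, hK'.2 k])
        (by simpa using hx)
      rw [Tet.permute_mul, Tet.permute_inv_permute] at this
      exact this)

theorem continuous_closeMap [TopologicalSpace ι] [DiscreteTopology ι] [TopologicalSpace κ]
    [DiscreteTopology κ] {K : PortedComplex ι} {K' : PortedComplex κ} (hK : K.PortLaw)
    (hK' : K'.PortLaw) (h : K.Space → K'.Space) (hport) (hc : Continuous h) :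
    Continuous (closeMap hK hK' h hport) :=
  continuous_lift _ _ _ fun t =>
    (continuous_lift _ _ _ fun t => continuous_pt _ t).comp (hc.comp (continuous_pt K t))

theorem closeMap_comp {K : PortedComplex ι} {K' : PortedComplex κ}
    (hK : K.PortLaw) (hK' : K'.PortLaw) (h : K.Space → K'.Space) (hport)
    (h' : K'.Space → K.Space) (hport') (hinv : ∀ x, h' (h x) = x) (x : K.close.Space) :
    closeMap hK' hK h' hport' (closeMap hK hK' h hport x) = x := by
  have key : ∀ y : K'.Space, closeMap hK' hK h' hport' ((K'.lift (fun t p => K'.close.pt t p)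
      (fun t f t' g hadj p hp => pt_eq_pt _ (by simp [close, hadj]) hp)) y) =
      (K.lift (fun t p => K.close.pt t p)
      (fun t f t' g hadj p hp => pt_eq_pt _ (by simp [close, hadj]) hp)) (h' y) := by
    intro y
    induction y using K'.ind with
    | h t p => rfl
  induction x using K.close.ind with
  | h t p =>
    refine (key (h (K.pt t p))).trans ?_
    rw [hinv]
    rfl

/-- Closing up respects homeomorphy relative to the ports. -/
theorem PortHomeo.close [TopologicalSpace ι] [DiscreteTopology ι] [TopologicalSpace κ]
    [DiscreteTopology κ] {K : PortedComplex ι} {K' : PortedComplex κ} (h : PortHomeo K K')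
    (hK : K.PortLaw) (hK' : K'.PortLaw) : Nonempty (K.close.Space ≃ₜ K'.close.Space) := by
  obtain ⟨e, he⟩ := h
  have he' : ∀ k x, x.1 3 = 0 → e.symm (K'.portPoint k x) = K.portPoint k x :=
    fun k x hx => by rw [← he k x hx, e.symm_apply_apply]
  exact ⟨⟨⟨closeMap hK hK' e he, closeMap hK' hK e.symm he',
    closeMap_comp hK hK' e he e.symm he' e.symm_apply_apply,
    closeMap_comp hK' hK e.symm he' e he e.apply_symm_apply⟩,
    continuous_closeMap hK hK' e he e.continuous,
    continuous_closeMap hK' hK e.symm he' e.symm.continuous⟩⟩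

end PortedComplex

/-! ### Stellar subdivision of one tetrahedron in barycentric coordinates -/

namespace Tet

/-- The least coordinate among those in `insert i s`. -/
def least (s : Finset (Fin 4)) (i : Fin 4) (q : Tet) : ℝ :=
  (insert i s).inf' (Finset.insert_nonempty i s) q.1

theorem least_le {s : Finset (Fin 4)} {i j : Fin 4} (q : Tet) (hj : j ∈ insert i s) :
    least s i q ≤ q.1 j :=
  Finset.inf'_le _ hj

theorem least_nonneg (s : Finset (Fin 4)) (i : Fin 4) (q : Tet) : 0 ≤ least s i q :=
  Finset.le_inf' _ _ fun j _ => q.2.1 j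

theorem least_eq {s : Finset (Fin 4)} {i : Fin 4} {q : Tet} (h : ∀ j ∈ s, q.1 i ≤ q.1 j) :
    least s i q = q.1 i := by
  refine le_antisymm (least_le q (Finset.mem_insert_self i s)) (Finset.le_inf' _ _ fun j hj => ?_)
  rcases Finset.mem_insert.1 hj with rfl | hj
  · exact le_rfl
  · exact h j hj

theorem continuous_least (s : Finset (Fin 4)) (i : Fin 4) : Continuous (least s i) :=
  Continuous.finset_inf'_apply _ fun j _ => (continuous_apply j).comp continuous_subtype_val

theorem card_insert_pos (s : Finset (Fin 4)) (i : Fin 4) : (0 : ℝ) < (insert i s).card :=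
  Nat.cast_pos.2 (Finset.card_pos.2 (Finset.insert_nonempty i s))

/-- The coordinates of the point `q` of a tetrahedron, in the piece of the stellar subdivision at
the face `insert i s` in which the vertex `i` is replaced by the barycentre of that face. They are
meaningful if `q i` is the least coordinate among those in `insert i s`. -/
def up (s : Finset (Fin 4)) (i : Fin 4) (q : Tet) : Tet :=
  ⟨fun j => q.1 j - (if j ∈ insert i s then least s i q else 0) +
      (if j = i then (insert i s).card * least s i q else 0), by
    constructor
    · intro j
      have h0 := least_nonneg s i q
      have h1 : 0 ≤ q.1 j - (if j ∈ insert i s then least s i q else 0) := by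
        split_ifs with h
        · exact sub_nonneg.2 (least_le q h)
        · simpa using q.2.1 j
      have h2 : 0 ≤ if j = i then (insert i s).card * least s i q else 0 := by
        split_ifs <;> positivity
      exact add_nonneg h1 h2
    · rw [Finset.sum_add_distrib, Finset.sum_sub_distrib, q.2.2]
      simp only [Finset.sum_ite_mem, Finset.univ_inter, Finset.sum_const, nsmul_eq_mul,
        Finset.sum_ite_eq', Finset.mem_univ, if_true]
      ring⟩

/-- The coordinates in a tetrahedron of the point `p` of the piece of its stellar subdivision at
the face `insert i s` in which the vertex `i` is replaced by the barycentre of that face. -/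
noncomputable def down (s : Finset (Fin 4)) (i : Fin 4) (p : Tet) : Tet :=
  ⟨fun j => p.1 j + (if j ∈ insert i s then p.1 i / (insert i s).card else 0) -
      (if j = i then p.1 i else 0), by
    have hc := card_insert_pos s i
    have hi := p.2.1 i
    constructor
    · intro j
      have h2 : 0 ≤ if j ∈ insert i s then p.1 i / (insert i s).card else 0 := by
        split_ifs <;> positivity
      have h3 : 0 ≤ p.1 j - (if j = i then p.1 i else 0) := by
        split_ifs with h
        · simp [h]
        · simpa using p.2.1 j
      linarith
    · rw [Finset.sum_sub_distrib, Finset.sum_add_distrib, p.2.2]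
      simp only [Finset.sum_ite_mem, Finset.univ_inter, Finset.sum_const, nsmul_eq_mul,
        Finset.sum_ite_eq', Finset.mem_univ, if_true]
      field_simp
      ring⟩

theorem up_val (s : Finset (Fin 4)) (i : Fin 4) (q : Tet) (j : Fin 4) :
    (up s i q).1 j = q.1 j - (if j ∈ insert i s then least s i q else 0) +
      (if j = i then (insert i s).card * least s i q else 0) := rfl

theorem down_val (s : Finset (Fin 4)) (i : Fin 4) (p : Tet) (j : Fin 4) :
    (down s i p).1 j = p.1 j + (if j ∈ insert i s then p.1 i / (insert i s).card else 0) -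
      (if j = i then p.1 i else 0) := rfl

theorem continuous_up (s : Finset (Fin 4)) (i : Fin 4) : Continuous (up s i) := by
  refine Continuous.subtype_mk (continuous_pi fun j => ?_) _
  have h := continuous_least s i
  have hj : Continuous fun q : Tet => q.1 j := (continuous_apply j).comp continuous_subtype_val
  refine (hj.sub ?_).add ?_
  · split_ifs
    exacts [h, continuous_const]
  · split_ifs
    exacts [continuous_const.mul h, continuous_const]

theorem continuous_down (s : Finset (Fin 4)) (i : Fin 4) : Continuous (down s i) := by
  refine Continuous.subtype_mk (continuous_pi fun j => ?_) _
  have h (j : Fin 4) : Continuous fun q : Tet => q.1 j :=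
    (continuous_apply j).comp continuous_subtype_val
  refine ((h j).add ?_).sub ?_
  · split_ifs
    exacts [(h i).div_const _, continuous_const]
  · split_ifs
    exacts [h i, continuous_const]

/-- If `q i` is the least weight on the face, taking that weight off every vertex of the face and
giving the total to the barycentre is an exact change of coordinates. Without this inequality the
value of `up` has no meaning. -/
theorem down_up {s : Finset (Fin 4)} {i : Fin 4} {q : Tet} (h : ∀ j ∈ s, q.1 i ≤ q.1 j) :
    down s i (up s i q) = q := by
  have hc := (card_insert_pos s i).ne'
  have hl := least_eq h
  ext j
  change (down s i (up s i q)).1 j = q.1 j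
  simp only [down_val, up_val, Finset.mem_insert_self, if_true, hl]
  by_cases hj : j = i
  · subst hj; simp
  · by_cases hjs : j ∈ insert i s <;> simp [hj, hjs]

theorem down_self (s : Finset (Fin 4)) (i : Fin 4) (p : Tet) :
    (down s i p).1 i = p.1 i / (insert i s).card := by
  simp [down_val]

theorem down_least {s : Finset (Fin 4)} {i j : Fin 4} (p : Tet) (hj : j ∈ s) :
    (down s i p).1 i ≤ (down s i p).1 j := by
  rw [down_self]
  by_cases h : j = i
  · subst h; rw [down_self]
  · rw [down_val, if_pos (Finset.mem_insert_of_mem hj), if_neg h]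
    have := p.2.1 j
    linarith

/-- No inequality is needed here: `down` spreads the weight of the barycentre evenly over the face,
so the coordinate `i` of the result is automatically least. -/
theorem up_down (s : Finset (Fin 4)) (i : Fin 4) (p : Tet) : up s i (down s i p) = p := by
  have hc := (card_insert_pos s i).ne'
  have hl : least s i (down s i p) = p.1 i / (insert i s).card := by
    rw [least_eq fun j hj => down_least p hj, down_self]
  ext j
  change (up s i (down s i p)).1 j = p.1 j
  rw [up_val, hl]
  by_cases hj : j = i
  · subst hj
    rw [down_self]
    simp
    field_simp
  · by_cases hjs : j ∈ insert i s <;> simp [down_val, hj, hjs]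

theorem up_eq_self {s : Finset (Fin 4)} {i : Fin 4} {q : Tet} (h : q.1 i = 0) : up s i q = q := by
  have hl : least s i q = 0 := by
    rw [least_eq fun j _ => h ▸ q.2.1 j, h]
  ext j
  change (up s i q).1 j = q.1 j
  simp [up_val, hl]

theorem down_eq_self {s : Finset (Fin 4)} {i : Fin 4} {p : Tet} (h : p.1 i = 0) :
    down s i p = p := by
  ext j
  change (down s i p).1 j = p.1 j
  simp [down_val, h]

theorem up_empty (i : Fin 4) (q : Tet) : up ∅ i q = q := by
  ext j
  change (up ∅ i q).1 j = q.1 j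
  by_cases hj : j = i <;> simp [up_val, hj]

theorem down_empty (i : Fin 4) (p : Tet) : down ∅ i p = p := by
  ext j
  change (down ∅ i p).1 j = p.1 j
  by_cases hj : j = i <;> simp [down_val, hj]

theorem permute_up {s : Finset (Fin 4)} {i : Fin 4} (g : Perm (Fin 4)) {q : Tet}
    (h : ∀ j ∈ s, q.1 i ≤ q.1 j) :
    up (s.image g) (g i) (permute g q) = permute g (up s i q) := by
  have hl : least (s.image g) (g i) (permute g q) = least s i q := by
    rw [least_eq h, least_eq]
    · simp
    · intro j hj
      obtain ⟨k, hk, rfl⟩ := Finset.mem_image.1 hj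
      simpa using h k hk
  have hc : (insert (g i) (s.image g)).card = (insert i s).card := by
    rw [← Finset.image_insert, Finset.card_image_of_injective _ g.injective]
  ext j
  obtain ⟨j, rfl⟩ := g.surjective j
  change (up (s.image g) (g i) (permute g q)).1 (g j) = (permute g (up s i q)).1 (g j)
  rw [up_val, hl, hc]
  simp [up_val, ← Finset.image_insert]

theorem permute_down {s : Finset (Fin 4)} {i : Fin 4} (g : Perm (Fin 4)) (p : Tet) :
    down (s.image g) (g i) (permute g p) = permute g (down s i p) := by
  have hc : (insert (g i) (s.image g)).card = (insert i s).card := by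
    rw [← Finset.image_insert, Finset.card_image_of_injective _ g.injective]
  ext j
  obtain ⟨j, rfl⟩ := g.surjective j
  change (down (s.image g) (g i) (permute g p)).1 (g j) = (permute g (down s i p)).1 (g j)
  rw [down_val, hc]
  simp [down_val, ← Finset.image_insert]

/-- The pieces at `i` and `j` meet along the wall `q i = q j`. There the old vertex `j` has weight
zero in the piece at `i`, and the barycentre stands in position `i` in one piece and in position `j`
in the other. Hence the transposition is the gluing map. -/
theorem up_swap {s : Finset (Fin 4)} {i j : Fin 4} {q : Tet} (hi : i ∈ s) (hj : j ∈ s)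
    (hij : i ≠ j) (hqi : ∀ k ∈ s, q.1 i ≤ q.1 k) (hqj : ∀ k ∈ s, q.1 j ≤ q.1 k) :
    (up s i q).1 j = 0 ∧ permute (swap i j) (up s i q) = up s j q := by
  have hli := least_eq hqi
  have hlj := least_eq hqj
  have heq : q.1 i = q.1 j := le_antisymm (hqi j hj) (hqj i hi)
  have h0 : (up s i q).1 j = 0 := by
    rw [up_val, hli, Finset.insert_eq_of_mem hi, if_pos hj, if_neg hij.symm, heq]
    simp
  refine ⟨h0, ?_⟩
  ext k
  change (up s i q).1 (swap i j k) = (up s j q).1 k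
  rw [up_val, up_val, hli, hlj, Finset.insert_eq_of_mem hi, Finset.insert_eq_of_mem hj]
  by_cases hki : k = i
  · subst hki; simp [hi, hj, hij, hij.symm, heq]
  · by_cases hkj : k = j
    · subst hkj; simp [hi, hj, heq]
    · rw [swap_apply_of_ne_of_ne hki hkj, heq]; simp [hki, hkj]

theorem down_swap {s : Finset (Fin 4)} {i j : Fin 4} {p : Tet} (hi : i ∈ s) (hj : j ∈ s)
    (hij : i ≠ j) (hp : p.1 j = 0) : down s j (permute (swap i j) p) = down s i p := by
  ext k
  change (down s j (permute (swap i j) p)).1 k = (down s i p).1 k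
  rw [down_val, down_val, Finset.insert_eq_of_mem hi, Finset.insert_eq_of_mem hj]
  by_cases hki : k = i
  · subst hki; simp [hi, hij, hp]
  · by_cases hkj : k = j
    · subst hkj; simp [hj, hp, hij.symm]
    · simp [hki, hkj, swap_apply_of_ne_of_ne]

end Tet

/-! ### Stellar subdivisions of complexes are homeomorphisms -/

namespace PortedComplex

variable {ι κ : Type}

/-- `L` is a stellar subdivision of `K`: the tetrahedron `t` is subdivided at its face `σ t`, or
not at all if `σ t` is empty. Its piece in which the vertex `i` is replaced by the barycentre of
that face is `(piece t i).1`, and `(piece t i).2` relabels its vertices. -/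
structure IsStellar (K : PortedComplex ι) (L : PortedComplex κ) (σ : ι → Finset (Fin 4))
    (piece : ι → Fin 4 → κ × Perm (Fin 4)) (parent : κ → ι × Fin 4) : Prop where
  piece_trivial : ∀ t, σ t = ∅ → ∀ i, piece t i = piece t 0
  parent_valid : ∀ s, σ (parent s).1 = ∅ ∨ (parent s).2 ∈ σ (parent s).1
  piece_parent : ∀ s, (piece (parent s).1 (parent s).2).1 = s
  parent_piece : ∀ t i, (σ t = ∅ ∨ i ∈ σ t) →
    (parent (piece t i).1).1 = t ∧ (σ t ≠ ∅ → (parent (piece t i).1).2 = i)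
  inner : ∀ t i j, i ∈ σ t → j ∈ σ t → i ≠ j → L.adj (piece t i).1 ((piece t i).2 j) =
    Sum.inl ((piece t j).1, (piece t j).2 * swap i j * (piece t i).2⁻¹)
  outer_glued : ∀ t f t' g, K.adj t f = Sum.inl (t', g) → (σ t = ∅ ∨ f ∈ σ t) →
    (σ t' = ∅ ∨ g f ∈ σ t') ∧ L.adj (piece t f).1 ((piece t f).2 f) =
      Sum.inl ((piece t' (g f)).1, (piece t' (g f)).2 * g * (piece t f).2⁻¹)
  outer_split : ∀ t f t' g, K.adj t f = Sum.inl (t', g) → ¬(σ t = ∅ ∨ f ∈ σ t) →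
    σ t' = (σ t).image g ∧ ∀ i ∈ σ t, L.adj (piece t i).1 ((piece t i).2 f) =
      Sum.inl ((piece t' (g i)).1, (piece t' (g i)).2 * g * (piece t i).2⁻¹)
  outer_port : ∀ t f k π, K.adj t f = Sum.inr (k, π) → (σ t = ∅ ∨ f ∈ σ t) ∧
    L.adj (piece t f).1 ((piece t f).2 f) = Sum.inr (k, π * (piece t f).2⁻¹)
  port : ∀ k, (σ (K.port k).1 = ∅ ∨ (K.port k).2 3 ∈ σ (K.port k).1) ∧
    L.port k = ((piece (K.port k).1 ((K.port k).2 3)).1,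
      (piece (K.port k).1 ((K.port k).2 3)).2 * (K.port k).2)

namespace IsStellar

variable {K : PortedComplex ι} {L : PortedComplex κ} {σ : ι → Finset (Fin 4)}
    {piece : ι → Fin 4 → κ × Perm (Fin 4)} {parent : κ → ι × Fin 4}

/-- The position of a point of the tetrahedron `t` in its piece at the vertex `i`. -/
def toPiece (L : PortedComplex κ) (σ : ι → Finset (Fin 4))
    (piece : ι → Fin 4 → κ × Perm (Fin 4)) (t : ι) (i : Fin 4) (q : Tet) : L.Space :=
  L.pt (piece t i).1 (Tet.permute (piece t i).2 (Tet.up (σ t) i q))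

/-- Several coordinates may be least at once; the inner gluings make the corresponding pieces agree.
Hence the arbitrary choice made in `toFine` is harmless. -/
theorem toPiece_eq (h : IsStellar K L σ piece parent) {t : ι} {i j : Fin 4} {q : Tet}
    (hi : σ t = ∅ ∨ i ∈ σ t) (hj : σ t = ∅ ∨ j ∈ σ t) (hqi : ∀ k ∈ σ t, q.1 i ≤ q.1 k)
    (hqj : ∀ k ∈ σ t, q.1 j ≤ q.1 k) :
    toPiece L σ piece t i q = toPiece L σ piece t j q := by
  by_cases hij : i = j
  · rw [hij]
  rcases eq_or_ne (σ t) ∅ with h0 | h0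
  · rw [toPiece, toPiece, h.piece_trivial t h0 i, h.piece_trivial t h0 j, h0, Tet.up_empty,
      Tet.up_empty]
  · replace hi := hi.resolve_left h0
    replace hj := hj.resolve_left h0
    obtain ⟨h1, h2⟩ := Tet.up_swap hi hj hij hqi hqj
    rw [toPiece, L.pt_eq_pt (h.inner t i j hi hj hij) (by simpa using h1), Tet.permute_mul,
      Tet.permute_inv_permute, Tet.permute_mul, h2, toPiece]

theorem exists_least (σ : ι → Finset (Fin 4)) (t : ι) (q : Tet) :
    ∃ i, (σ t = ∅ ∨ i ∈ σ t) ∧ ∀ k ∈ σ t, q.1 i ≤ q.1 k := by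
  rcases (σ t).eq_empty_or_nonempty with h0 | h0
  · exact ⟨0, Or.inl h0, by simp [h0]⟩
  · obtain ⟨i, hi, h⟩ := (σ t).exists_min_image q.1 h0
    exact ⟨i, Or.inr hi, h⟩

/-- The position of a point of the tetrahedron `t` in the subdivision. -/
noncomputable def toFine (L : PortedComplex κ) (σ : ι → Finset (Fin 4))
    (piece : ι → Fin 4 → κ × Perm (Fin 4)) (t : ι) (q : Tet) : L.Space :=
  toPiece L σ piece t (exists_least σ t q).choose q

theorem toFine_eq (h : IsStellar K L σ piece parent) {t : ι} {i : Fin 4} {q : Tet}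
    (hi : σ t = ∅ ∨ i ∈ σ t) (hqi : ∀ k ∈ σ t, q.1 i ≤ q.1 k) :
    toFine L σ piece t q = toPiece L σ piece t i q :=
  h.toPiece_eq (exists_least σ t q).choose_spec.1 hi (exists_least σ t q).choose_spec.2 hqi

/-- A face opposite to a vertex of the subdivided simplex does not contain that simplex. It stays
whole inside the piece at `f`, on which `up` is the identity. -/
theorem toFine_face (h : IsStellar K L σ piece parent) {t : ι} {f : Fin 4} {q : Tet}
    (hf : σ t = ∅ ∨ f ∈ σ t) (hq : q.1 f = 0) :
    toFine L σ piece t q = L.pt (piece t f).1 (Tet.permute (piece t f).2 q) := by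
  rw [h.toFine_eq hf fun k _ => hq ▸ q.2.1 k, toPiece, Tet.up_eq_self hq]

/-- The sets on which a given coordinate is least are finitely many closed sets covering the
tetrahedron, and on each of them `toFine` is one continuous formula. -/
theorem continuous_toFine [TopologicalSpace κ] (h : IsStellar K L σ piece parent) (t : ι) :
    Continuous (toFine L σ piece t) := by
  have hcont (j : Fin 4) : Continuous fun q : Tet => q.1 j :=
    (continuous_apply j).comp continuous_subtype_val
  refine LocallyFinite.continuous (f := fun i : {i : Fin 4 // σ t = ∅ ∨ i ∈ σ t} =>
    {q : Tet | ∀ k ∈ σ t, q.1 i ≤ q.1 k}) (locallyFinite_of_finite _) ?_ ?_ ?_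
  · refine Set.eq_univ_of_forall fun q => Set.mem_iUnion.2 ?_
    obtain ⟨i, hi, hq⟩ := exists_least σ t q
    exact ⟨⟨i, hi⟩, hq⟩
  · intro i
    simp only [Set.ofPred_forall]
    exact isClosed_iInter fun k => isClosed_iInter fun _ => isClosed_le (hcont _) (hcont _)
  · rintro ⟨i, hi⟩
    refine ContinuousOn.congr (f := toPiece L σ piece t i) (Continuous.continuousOn ?_)
      fun q hq => h.toFine_eq hi hq
    exact (continuous_pt L _).comp ((Tet.continuous_permute _).comp (Tet.continuous_up _ _))

/-- The map to the subdivision. -/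
noncomputable def fineMap (h : IsStellar K L σ piece parent) : K.Space → L.Space :=
  K.lift (toFine L σ piece) (by
    intro t f t' g hadj q hq
    -- Face `f` is cut exactly when `σ t` is non-empty and misses `f`, that is, when the subdivided
    -- simplex lies in this face. The neighbour must then be cut along the image simplex.
    by_cases hf : σ t = ∅ ∨ f ∈ σ t
    · obtain ⟨hf', hL⟩ := h.outer_glued t f t' g hadj hf
      rw [h.toFine_face hf hq, h.toFine_face hf' (by simpa using hq),
        L.pt_eq_pt hL (by simpa using hq), Tet.permute_mul, Tet.permute_inv_permute,
        Tet.permute_mul]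
    · obtain ⟨hσ, hL⟩ := h.outer_split t f t' g hadj hf
      obtain ⟨i, hi, hqi⟩ := exists_least σ t q
      rw [not_or] at hf
      have hi' := hi.resolve_left hf.1
      have hfi : f ≠ i := fun e => hf.2 (e ▸ hi')
      rw [h.toFine_eq hi hqi, h.toFine_eq (i := g i)
        (Or.inr (hσ ▸ Finset.mem_image_of_mem g hi')), toPiece, toPiece, hσ,
        Tet.permute_up g hqi, L.pt_eq_pt (hL i hi'), Tet.permute_mul, Tet.permute_inv_permute,
        Tet.permute_mul]
      · simpa [Tet.up_val, hfi, hf.2] using hq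
      · intro k hk
        rw [hσ] at hk
        obtain ⟨k', hk', rfl⟩ := Finset.mem_image.1 hk
        simpa using hqi k' hk')

/-- The position in `K` of a point of a tetrahedron of the subdivision. -/
noncomputable def toCoarse (K : PortedComplex ι) (σ : ι → Finset (Fin 4))
    (piece : ι → Fin 4 → κ × Perm (Fin 4)) (parent : κ → ι × Fin 4) (s : κ) (p : Tet) : K.Space :=
  K.pt (parent s).1 (Tet.down (σ (parent s).1) (parent s).2
    (Tet.permute (piece (parent s).1 (parent s).2).2⁻¹ p))

theorem toCoarse_piece (h : IsStellar K L σ piece parent) {t : ι} {i : Fin 4}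
    (hi : σ t = ∅ ∨ i ∈ σ t) (p : Tet) :
    toCoarse K σ piece parent (piece t i).1 (Tet.permute (piece t i).2 p) =
      K.pt t (Tet.down (σ t) i p) := by
  obtain ⟨h1, h2⟩ := h.parent_piece t i hi
  rw [toCoarse, h1]
  rcases eq_or_ne (σ t) ∅ with h0 | h0
  · rw [h0, Tet.down_empty, Tet.down_empty, h.piece_trivial t h0 i, h.piece_trivial t h0
      (parent _).2, Tet.permute_inv_permute]
  · rw [h2 h0, Tet.permute_inv_permute]

/-- The map from the subdivision. -/
noncomputable def coarseMap (h : IsStellar K L σ piece parent) : L.Space → K.Space :=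
  L.lift (toCoarse K σ piece parent) (by
    intro s f' s' g' hadj p hp
    have hs := h.piece_parent s
    have hi := h.parent_valid s
    generalize ht : (parent s).1 = t at hs hi
    generalize hie : (parent s).2 = i at hs hi
    obtain ⟨f, rfl⟩ := (piece t i).2.surjective f'
    obtain ⟨p, rfl⟩ : ∃ p', p = Tet.permute (piece t i).2 p' :=
      ⟨_, (Tet.permute_permute_inv _ _).symm⟩
    subst hs
    replace hp : p.1 f = 0 := by simpa using hp
    rw [h.toCoarse_piece hi]
    clear ht hie
    by_cases hf : σ t = ∅ ∨ f ∈ σ t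
    · by_cases hfi : σ t ≠ ∅ ∧ f ≠ i
      · have hf' := hf.resolve_left hfi.1
        have hi' := hi.resolve_left hfi.1
        rw [h.inner t i f hi' hf' hfi.2.symm] at hadj
        simp only [Sum.inl.injEq, Prod.mk.injEq] at hadj
        obtain ⟨rfl, rfl⟩ := hadj
        rw [Tet.permute_mul, Tet.permute_inv_permute, Tet.permute_mul, h.toCoarse_piece hf,
          Tet.down_swap hi' hf' hfi.2.symm hp]
      · have hpiece : piece t i = piece t f := by
          by_cases h0 : σ t = ∅
          · rw [h.piece_trivial t h0 i, h.piece_trivial t h0 f]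
          · rw [not_and, not_not] at hfi
            rw [hfi h0]
        have hdown : Tet.down (σ t) i p = p := by
          by_cases h0 : σ t = ∅
          · rw [h0, Tet.down_empty]
          · rw [not_and, not_not] at hfi
            rw [← hfi h0, Tet.down_eq_self hp]
        rw [hpiece] at hadj
        rw [hdown, hpiece]
        rcases hK : K.adj t f with ⟨t', g⟩ | ⟨k, π⟩
        · obtain ⟨hf', hL⟩ := h.outer_glued t f t' g hK hf
          rw [hL] at hadj
          simp only [Sum.inl.injEq, Prod.mk.injEq] at hadj
          obtain ⟨rfl, rfl⟩ := hadj
          rw [Tet.permute_mul, Tet.permute_inv_permute, Tet.permute_mul, h.toCoarse_piece hf',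
            Tet.down_eq_self (by simpa using hp), K.pt_eq_pt hK hp]
        · rw [(h.outer_port t f k π hK).2] at hadj
          simp at hadj
    · rcases hK : K.adj t f with ⟨t', g⟩ | ⟨k, π⟩
      · obtain ⟨hσ, hL⟩ := h.outer_split t f t' g hK hf
        rw [not_or] at hf
        have hi' := hi.resolve_left hf.1
        have hfi : f ≠ i := fun e => hf.2 (e ▸ hi')
        rw [hL i hi'] at hadj
        simp only [Sum.inl.injEq, Prod.mk.injEq] at hadj
        obtain ⟨rfl, rfl⟩ := hadj
        rw [Tet.permute_mul, Tet.permute_inv_permute, Tet.permute_mul,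
          h.toCoarse_piece (Or.inr (hσ ▸ Finset.mem_image_of_mem g hi')), hσ, Tet.permute_down,
          K.pt_eq_pt hK]
        simpa [Tet.down_val, hfi, hf.2] using hp
      · exact absurd (h.outer_port t f k π hK).1 hf)

/-- A complex is homeomorphic to its stellar subdivisions. -/
theorem portHomeo [TopologicalSpace ι] [DiscreteTopology ι] [TopologicalSpace κ]
    [DiscreteTopology κ] (h : IsStellar K L σ piece parent) : PortHomeo K L := by
  refine ⟨⟨⟨h.fineMap, h.coarseMap, ?_, ?_⟩, ?_, ?_⟩, ?_⟩
  · intro x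
    induction x using K.ind with
    | h t q =>
      obtain ⟨i, hi, hqi⟩ := exists_least σ t q
      change h.coarseMap (toFine L σ piece t q) = _
      rw [h.toFine_eq hi hqi]
      refine (h.toCoarse_piece hi _).trans ?_
      rw [Tet.down_up hqi]
  · intro x
    induction x using L.ind with
    | h s p =>
      change toFine L σ piece (parent s).1 (Tet.down (σ (parent s).1) (parent s).2
        (Tet.permute (piece (parent s).1 (parent s).2).2⁻¹ p)) = _
      rw [h.toFine_eq (h.parent_valid s) fun k hk => Tet.down_least _ hk, toPiece, Tet.up_down,
        h.piece_parent, Tet.permute_permute_inv]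
  · change Continuous h.fineMap
    unfold fineMap
    exact continuous_lift _ _ _ h.continuous_toFine
  · change Continuous h.coarseMap
    unfold coarseMap
    refine continuous_lift _ _ _ fun s => ?_
    exact (continuous_pt K _).comp ((Tet.continuous_down _ _).comp (Tet.continuous_permute _))
  · intro k x hx
    obtain ⟨h1, h2⟩ := h.port k
    change toFine L σ piece (K.port k).1 (Tet.permute (K.port k).2 x) = _
    rw [h.toFine_face h1 (by simpa using hx), portPoint, h2, Tet.permute_mul]

end IsStellar

/-! ### Deciding whether one explicit complex subdivides another -/

/-- Decidable equality of a sum, in a form that reduces well. -/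
@[reducible] def sumDecidableEq {α β : Type*} [DecidableEq α] [DecidableEq β] :
    DecidableEq (α ⊕ β)
  | Sum.inl _, Sum.inl _ => decidable_of_iff _ Sum.inl_injective.eq_iff.symm
  | Sum.inr _, Sum.inr _ => decidable_of_iff _ Sum.inr_injective.eq_iff.symm
  | Sum.inl _, Sum.inr _ => isFalse Sum.inl_ne_inr
  | Sum.inr _, Sum.inl _ => isFalse Sum.inr_ne_inl

/-- The conditions on the face `f` of the tetrahedron `t` under which `L` is a stellar subdivision
of `K`. -/
def FaceCheck (K : PortedComplex ι) (L : PortedComplex κ) (σ : ι → Finset (Fin 4))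
    (piece : ι → Fin 4 → κ × Perm (Fin 4)) (t : ι) (f : Fin 4) : Prop :=
  match K.adj t f with
  | Sum.inl (t', g) => if σ t = ∅ ∨ f ∈ σ t then
      (σ t' = ∅ ∨ g f ∈ σ t') ∧ L.adj (piece t f).1 ((piece t f).2 f) =
        Sum.inl ((piece t' (g f)).1, (piece t' (g f)).2 * g * (piece t f).2⁻¹)
    else σ t' = (σ t).image g ∧ ∀ i ∈ σ t, L.adj (piece t i).1 ((piece t i).2 f) =
        Sum.inl ((piece t' (g i)).1, (piece t' (g i)).2 * g * (piece t i).2⁻¹)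
  | Sum.inr (k, π) => (σ t = ∅ ∨ f ∈ σ t) ∧
      L.adj (piece t f).1 ((piece t f).2 f) = Sum.inr (k, π * (piece t f).2⁻¹)

instance [DecidableEq ι] [DecidableEq κ] (K : PortedComplex ι) (L : PortedComplex κ)
    (σ : ι → Finset (Fin 4)) (piece : ι → Fin 4 → κ × Perm (Fin 4)) (t : ι) (f : Fin 4) :
    Decidable (FaceCheck K L σ piece t f) := by
  letI : DecidableEq ((κ × Perm (Fin 4)) ⊕ (Bool × Perm (Fin 4))) := sumDecidableEq
  delta FaceCheck
  exact match K.adj t f with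
    | Sum.inl (t', g) => inferInstance
    | Sum.inr (k, π) => inferInstance

/-- The conditions under which `L` is a stellar subdivision of `K`, in a form that can be decided
for explicit finite complexes. -/
def StellarCheck (K : PortedComplex ι) (L : PortedComplex κ) (σ : ι → Finset (Fin 4))
    (piece : ι → Fin 4 → κ × Perm (Fin 4)) : Prop :=
  (∀ t, σ t = ∅ → ∀ i, piece t i = piece t 0) ∧
  (∀ s, ∃ t i, (σ t = ∅ ∨ i ∈ σ t) ∧ (piece t i).1 = s) ∧
  (∀ t i t' i', (σ t = ∅ ∨ i ∈ σ t) → (σ t' = ∅ ∨ i' ∈ σ t') →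
    (piece t i).1 = (piece t' i').1 → t = t' ∧ (σ t = ∅ ∨ i = i')) ∧
  (∀ t i j, i ∈ σ t → j ∈ σ t → i ≠ j → L.adj (piece t i).1 ((piece t i).2 j) =
    Sum.inl ((piece t j).1, (piece t j).2 * swap i j * (piece t i).2⁻¹)) ∧
  (∀ t f, FaceCheck K L σ piece t f) ∧
  ∀ k, (σ (K.port k).1 = ∅ ∨ (K.port k).2 3 ∈ σ (K.port k).1) ∧
    L.port k = ((piece (K.port k).1 ((K.port k).2 3)).1,
      (piece (K.port k).1 ((K.port k).2 3)).2 * (K.port k).2)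

instance [Fintype ι] [Fintype κ] [DecidableEq ι] [DecidableEq κ] (K : PortedComplex ι)
    (L : PortedComplex κ) (σ : ι → Finset (Fin 4)) (piece : ι → Fin 4 → κ × Perm (Fin 4)) :
    Decidable (StellarCheck K L σ piece) := by
  letI : DecidableEq ((κ × Perm (Fin 4)) ⊕ (Bool × Perm (Fin 4))) := sumDecidableEq
  delta StellarCheck
  iterate 5 refine @instDecidableAnd _ _ ?_ ?_; swap
  all_goals infer_instance

/-- The check makes the valid pairs `(t, i)` enumerate the tetrahedra of `L`, with an undivided `t`
counted once. So `parent` requires no data and can be chosen. -/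
theorem StellarCheck.isStellar {K : PortedComplex ι} {L : PortedComplex κ}
    {σ : ι → Finset (Fin 4)} {piece : ι → Fin 4 → κ × Perm (Fin 4)}
    (h : StellarCheck K L σ piece) : ∃ parent, IsStellar K L σ piece parent := by
  obtain ⟨h1, h2, h3, h4, h5, h6⟩ := h
  choose p q hpq using h2
  refine ⟨fun s => (p s, q s), h1, fun s => (hpq s).1, fun s => (hpq s).2, ?_, h4, ?_, ?_, ?_, h6⟩
  · intro t i hi
    obtain ⟨ht, hi'⟩ := h3 _ _ _ _ (hpq (piece t i).1).1 hi (hpq (piece t i).1).2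
    refine ⟨ht, fun h0 => hi'.resolve_left ?_⟩
    rwa [ht]
  · intro t f t' g hadj hf
    have := h5 t f
    rw [FaceCheck, hadj] at this
    simpa only [if_pos hf] using this
  · intro t f t' g hadj hf
    have := h5 t f
    rw [FaceCheck, hadj] at this
    simpa only [if_neg hf] using this
  · intro t f k π hadj
    have := h5 t f
    rw [FaceCheck, hadj] at this
    exact this

theorem portHomeo_of_stellarCheck [TopologicalSpace ι] [DiscreteTopology ι] [TopologicalSpace κ]
    [DiscreteTopology κ] {K : PortedComplex ι} {L : PortedComplex κ}
    {σ : ι → Finset (Fin 4)} {piece : ι → Fin 4 → κ × Perm (Fin 4)}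
    (h : StellarCheck K L σ piece) : PortHomeo K L := by
  obtain ⟨parent, hp⟩ := h.isStellar
  exact hp.portHomeo

/-! ### Explicit complexes and the Pachner moves between them -/

/-- The permutation with the given values, if there is one. -/
def permOfValues (w : Fin 4 → Fin 4) : Perm (Fin 4) :=
  let w' : Fin 4 → Fin 4 := fun v =>
    if w 0 = v then 0 else if w 1 = v then 1 else if w 2 = v then 2 else 3
  if h : (∀ v, w' (w v) = v) ∧ ∀ v, w (w' v) = v then ⟨w, w', h.1, h.2⟩ else 1

/-- The permutation whose values are the four decimal digits of a number. -/
def permOfDigits (m : ℕ) : Perm (Fin 4) :=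
  permOfValues ![Fin.ofNat 4 (m / 1000), Fin.ofNat 4 (m / 100 % 10), Fin.ofNat 4 (m / 10 % 10),
    Fin.ofNat 4 (m % 10)]

/-- The complex with tetrahedra `0, …, n-1` given by a table with a row for every tetrahedron and
a column for every face. The entries `n` and `n+1` in place of the adjacent tetrahedron mark the
ports, and permutations are given by their digits. -/
def ofTable {n : ℕ} (tab : Fin n → Fin 4 → ℕ × ℕ) (p q : Fin n × ℕ) : PortedComplex (Fin n) where
  adj t f := if h : (tab t f).1 < n then Sum.inl (⟨(tab t f).1, h⟩, permOfDigits (tab t f).2)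
    else Sum.inr ((tab t f).1 != n, permOfDigits (tab t f).2)
  port k := if k then (q.1, permOfDigits q.2) else (p.1, permOfDigits p.2)

/-- The pieces of a stellar subdivision, given by a table. -/
def pieceOfTable {m n : ℕ} (tab : Fin m → Fin 4 → Fin n × ℕ) (t : Fin m) (i : Fin 4) :
    Fin n × Perm (Fin 4) :=
  ((tab t i).1, permOfDigits (tab t i).2)

/-- The snapped ball: a tetrahedron with the faces `0` and `1` folded together. -/
def snapped : PortedComplex (Fin 1) := ofTable
  ![![(0, 1023), (0, 1023), (2, 132), (1, 123)]]
  (0, 123) (0, 132)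

/-- A ball made of four tetrahedra, three of which are snapped. -/
def block : PortedComplex (Fin 4) := ofTable
  ![![(0, 3120), (1, 123), (4, 132), (0, 3120)],
    ![(2, 123), (0, 123), (3, 123), (3, 123)],
    ![(1, 123), (2, 321), (5, 2130), (2, 321)],
    ![(3, 1023), (3, 1023), (1, 123), (1, 123)]]
  (0, 132) (2, 3102)

/-- The stages run from `snapped.glue block`, with its tetrahedra renumbered, to the snapped
tetrahedron coned from its barycentre. Consecutive stages differ by a 2-3 move or its inverse. In
the tables a leading zero is dropped, so `123` is the identity. -/
def snappedBlockStage0 : PortedComplex (Fin 5) := ofTable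
  ![![(0, 1023), (0, 1023), (1, 123), (5, 123)],
    ![(1, 3120), (2, 123), (0, 123), (1, 3120)],
    ![(3, 123), (1, 123), (4, 123), (4, 123)],
    ![(2, 123), (3, 321), (6, 2130), (3, 321)],
    ![(4, 1023), (4, 1023), (2, 123), (2, 123)]]
  (0, 123) (3, 3102)

def snappedBlockStage1 : PortedComplex (Fin 6) := ofTable
  ![![(0, 1023), (0, 1023), (1, 123), (6, 123)],
    ![(2, 123), (3, 123), (0, 123), (4, 123)],
    ![(1, 123), (5, 123), (4, 3120), (4, 3120)],
    ![(3, 2103), (1, 123), (3, 2103), (4, 321)],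
    ![(2, 3120), (3, 321), (2, 3120), (1, 123)],
    ![(7, 3210), (2, 123), (5, 132), (5, 132)]]
  (0, 123) (5, 3210)

def snappedBlockStage2 : PortedComplex (Fin 5) := ofTable
  ![![(0, 1023), (0, 1023), (1, 123), (5, 123)],
    ![(2, 123), (2, 123), (0, 123), (3, 123)],
    ![(1, 123), (1, 123), (3, 3120), (3, 3120)],
    ![(2, 3120), (4, 123), (2, 3120), (1, 123)],
    ![(4, 3120), (3, 123), (6, 231), (4, 3120)]]
  (0, 123) (4, 312)

def snappedBlockStage3 : PortedComplex (Fin 6) := ofTable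
  ![![(1, 123), (2, 123), (3, 123), (6, 123)],
    ![(0, 123), (2, 1023), (4, 123), (2, 1023)],
    ![(1, 1023), (0, 123), (4, 2013), (1, 1023)],
    ![(4, 123), (5, 123), (0, 123), (4, 123)],
    ![(3, 123), (2, 1203), (1, 123), (3, 123)],
    ![(5, 2103), (3, 123), (5, 2103), (7, 213)]]
  (0, 123) (5, 213)

def snappedBlockStage4 : PortedComplex (Fin 5) := ofTable
  ![![(1, 123), (1, 123), (2, 123), (5, 123)],
    ![(0, 123), (0, 123), (2, 2103), (3, 123)],
    ![(1, 2103), (4, 123), (0, 123), (3, 3102)],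
    ![(3, 1023), (3, 1023), (2, 2130), (1, 123)],
    ![(4, 2103), (2, 123), (4, 2103), (6, 213)]]
  (0, 123) (4, 213)

def snappedBlockStage5 : PortedComplex (Fin 4) := ofTable
  ![![(1, 123), (2, 123), (1, 123), (4, 123)],
    ![(0, 123), (2, 1023), (0, 123), (2, 1023)],
    ![(1, 1023), (0, 123), (3, 123), (1, 1023)],
    ![(3, 1023), (3, 1023), (2, 123), (5, 1023)]]
  (0, 123) (3, 1023)

def snappedBlockStage6 : PortedComplex (Fin 5) := ofTable
  ![![(1, 123), (2, 123), (1, 123), (5, 123)],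
    ![(0, 123), (3, 123), (0, 123), (4, 123)],
    ![(3, 123), (0, 123), (3, 123), (4, 1320)],
    ![(2, 123), (1, 123), (2, 123), (4, 321)],
    ![(2, 3021), (3, 321), (6, 132), (1, 123)]]
  (0, 123) (4, 132)

def snappedBlockStage7 : PortedComplex (Fin 4) := ofTable
  ![![(1, 123), (2, 123), (3, 123), (4, 123)],
    ![(0, 123), (2, 1023), (3, 2103), (2, 1023)],
    ![(1, 1023), (0, 123), (3, 213), (1, 1023)],
    ![(1, 2103), (2, 213), (0, 123), (5, 123)]]
  (0, 123) (3, 123)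

/-- Each fine complex is a common stellar subdivision of two consecutive stages: the two tetrahedra
on one side of the move, and the three on the other, are both cut into the same six. -/
def snappedBlockStage0Fine : PortedComplex (Fin 9) := ofTable
  ![![(0, 1023), (0, 1023), (2, 123), (9, 123)],
    ![(3, 3120), (4, 123), (2, 2103), (3, 3120)],
    ![(1, 2103), (5, 123), (0, 123), (3, 132)],
    ![(1, 3120), (6, 123), (2, 132), (1, 3120)],
    ![(7, 123), (1, 123), (5, 2103), (6, 3120)],
    ![(4, 2103), (2, 123), (8, 123), (6, 132)],
    ![(4, 3120), (3, 123), (5, 132), (8, 123)],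
    ![(4, 123), (7, 321), (10, 2130), (7, 321)],
    ![(8, 1023), (8, 1023), (5, 123), (6, 123)]]
  (0, 123) (7, 3102)

def snappedBlockStage1Fine : PortedComplex (Fin 9) := ofTable
  ![![(0, 1023), (0, 1023), (2, 123), (9, 123)],
    ![(3, 123), (4, 123), (2, 2103), (6, 123)],
    ![(1, 2103), (5, 123), (0, 123), (7, 123)],
    ![(1, 123), (8, 123), (7, 3120), (6, 3120)],
    ![(5, 2103), (1, 123), (5, 2103), (6, 321)],
    ![(4, 2103), (2, 123), (4, 2103), (7, 321)],
    ![(3, 3120), (4, 321), (7, 2103), (1, 123)],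
    ![(6, 2103), (5, 321), (3, 3120), (2, 123)],
    ![(10, 3210), (3, 123), (8, 132), (8, 132)]]
  (0, 123) (8, 3210)

def snappedBlockStage2Fine : PortedComplex (Fin 9) := ofTable
  ![![(1, 1023), (1, 1023), (3, 123), (2, 3120)],
    ![(0, 1023), (0, 1023), (4, 123), (2, 321)],
    ![(0, 3120), (1, 321), (5, 123), (9, 123)],
    ![(6, 123), (4, 1023), (0, 123), (5, 3120)],
    ![(3, 1023), (6, 123), (1, 123), (5, 321)],
    ![(3, 3120), (4, 321), (2, 123), (7, 123)],
    ![(3, 123), (4, 123), (7, 3120), (7, 3120)],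
    ![(6, 3120), (8, 123), (6, 3120), (5, 123)],
    ![(8, 3120), (7, 123), (10, 231), (8, 3120)]]
  (2, 123) (8, 312)

def snappedBlockStage3Fine : PortedComplex (Fin 9) := ofTable
  ![![(1, 123), (3, 123), (5, 123), (9, 123)],
    ![(0, 123), (3, 1023), (6, 123), (2, 3120)],
    ![(1, 3120), (4, 1023), (7, 123), (4, 1023)],
    ![(1, 1023), (0, 123), (6, 2013), (4, 321)],
    ![(2, 1023), (3, 321), (7, 2013), (2, 1023)],
    ![(6, 123), (8, 123), (0, 123), (7, 123)],
    ![(5, 123), (3, 1203), (1, 123), (7, 3120)],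
    ![(6, 3120), (4, 1203), (2, 123), (5, 123)],
    ![(8, 2103), (5, 123), (8, 2103), (10, 213)]]
  (0, 123) (8, 213)

def snappedBlockStage4Fine : PortedComplex (Fin 8) := ofTable
  ![![(1, 123), (2, 123), (4, 123), (8, 123)],
    ![(0, 123), (2, 1023), (4, 2103), (5, 123)],
    ![(1, 1023), (0, 123), (3, 2103), (6, 123)],
    ![(2, 2103), (7, 123), (4, 213), (6, 3102)],
    ![(1, 2103), (3, 213), (0, 123), (5, 3102)],
    ![(6, 1023), (6, 1023), (4, 2130), (1, 123)],
    ![(5, 1023), (5, 1023), (3, 2130), (2, 123)],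
    ![(7, 2103), (3, 123), (7, 2103), (9, 213)]]
  (0, 123) (7, 213)

def snappedBlockStage5Fine : PortedComplex (Fin 8) := ofTable
  ![![(1, 123), (3, 123), (1, 123), (8, 123)],
    ![(0, 123), (2, 1023), (0, 123), (4, 1023)],
    ![(1, 1023), (3, 1023), (5, 123), (4, 3120)],
    ![(2, 1023), (0, 123), (6, 123), (4, 321)],
    ![(2, 3120), (3, 321), (7, 123), (1, 1023)],
    ![(6, 1023), (6, 1023), (2, 123), (7, 3120)],
    ![(5, 1023), (5, 1023), (3, 123), (7, 321)],
    ![(5, 3120), (6, 321), (4, 123), (9, 1023)]]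
  (0, 123) (7, 1023)

def snappedBlockStage6Fine : PortedComplex (Fin 8) := ofTable
  ![![(1, 123), (3, 123), (2, 123), (8, 123)],
    ![(0, 123), (4, 123), (2, 2103), (6, 123)],
    ![(1, 2103), (5, 123), (0, 123), (7, 123)],
    ![(4, 123), (0, 123), (5, 123), (6, 1320)],
    ![(3, 123), (1, 123), (5, 2103), (6, 321)],
    ![(4, 2103), (2, 123), (3, 123), (7, 321)],
    ![(3, 3021), (4, 321), (7, 2103), (1, 123)],
    ![(6, 2103), (5, 321), (9, 132), (2, 123)]]
  (0, 123) (7, 132)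

/-- A 2-3 move. Subdividing at the triangle shared by two tetrahedra, or at the edge shared by the
three that replace them, gives the same complex. The later stages follow the same pattern, sometimes
in the opposite direction. -/
theorem stage0_portHomeo_stage1 : PortHomeo snappedBlockStage0 snappedBlockStage1 :=
  (portHomeo_of_stellarCheck (L := snappedBlockStage0Fine)
    (σ := ![∅, {0, 2, 3}, {0, 2, 3}, ∅, ∅])
    (piece := pieceOfTable ![fun _ => (0, 123),
      ![(1, 123), (1, 123), (2, 123), (3, 123)],
      ![(4, 123), (4, 123), (5, 123), (6, 123)],
      fun _ => (7, 123),
      fun _ => (8, 123)])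
    (by decide +kernel)).trans
  (portHomeo_of_stellarCheck (L := snappedBlockStage0Fine)
    (σ := ![∅, {1, 2}, {1, 2}, ∅, {1, 2}, ∅])
    (piece := pieceOfTable ![fun _ => (0, 123),
      ![(5, 213), (5, 213), (2, 123), (5, 213)],
      ![(4, 2013), (4, 2013), (1, 2103), (4, 2013)],
      fun _ => (8, 213),
      ![(6, 312), (6, 312), (3, 132), (6, 312)],
      fun _ => (7, 2013)])
    (by decide +kernel)).symm

theorem stage1_portHomeo_stage2 : PortHomeo snappedBlockStage1 snappedBlockStage2 :=
  (portHomeo_of_stellarCheck (L := snappedBlockStage1Fine)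
    (σ := ![∅, {0, 2}, ∅, {0, 2}, {0, 2}, ∅])
    (piece := pieceOfTable ![fun _ => (0, 123),
      ![(1, 123), (1, 123), (2, 123), (1, 123)],
      fun _ => (3, 123),
      ![(4, 123), (4, 123), (5, 123), (4, 123)],
      ![(6, 123), (6, 123), (7, 123), (6, 123)],
      fun _ => (8, 123)])
    (by decide +kernel)).trans
  (portHomeo_of_stellarCheck (L := snappedBlockStage1Fine)
    (σ := ![∅, {1, 2, 3}, {1, 2, 3}, ∅, ∅])
    (piece := pieceOfTable ![fun _ => (0, 123),
      ![(5, 213), (5, 213), (2, 123), (7, 132)],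
      ![(4, 2013), (4, 2013), (1, 2103), (6, 2130)],
      fun _ => (3, 3102),
      fun _ => (8, 3102)])
    (by decide +kernel)).symm

theorem stage2_portHomeo_stage3 : PortHomeo snappedBlockStage2 snappedBlockStage3 :=
  (portHomeo_of_stellarCheck (L := snappedBlockStage2Fine)
    (σ := ![{0, 1, 3}, {0, 1, 3}, ∅, ∅, ∅])
    (piece := pieceOfTable ![![(0, 123), (1, 123), (0, 123), (2, 123)],
      ![(3, 123), (4, 123), (3, 123), (5, 123)],
      fun _ => (6, 123),
      fun _ => (7, 123),
      fun _ => (8, 123)])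
    (by decide +kernel)).trans
  (portHomeo_of_stellarCheck (L := snappedBlockStage2Fine)
    (σ := ![{2, 3}, {2, 3}, {2, 3}, ∅, ∅, ∅])
    (piece := pieceOfTable ![![(5, 132), (5, 132), (5, 132), (2, 123)],
      ![(3, 3102), (3, 3102), (3, 3102), (0, 3120)],
      ![(4, 312), (4, 312), (4, 312), (1, 321)],
      fun _ => (7, 132),
      fun _ => (6, 3102),
      fun _ => (8, 132)])
    (by decide +kernel)).symm

theorem stage3_portHomeo_stage4 : PortHomeo snappedBlockStage3 snappedBlockStage4 :=
  (portHomeo_of_stellarCheck (L := snappedBlockStage3Fine)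
    (σ := ![∅, {0, 3}, {1, 3}, ∅, {0, 3}, ∅])
    (piece := pieceOfTable ![fun _ => (0, 123),
      ![(1, 123), (1, 123), (1, 123), (2, 123)],
      ![(3, 123), (3, 123), (3, 123), (4, 123)],
      fun _ => (5, 123),
      ![(6, 123), (6, 123), (6, 123), (7, 123)],
      fun _ => (8, 123)])
    (by decide +kernel)).trans
  (portHomeo_of_stellarCheck (L := snappedBlockStage3Fine)
    (σ := ![∅, {0, 1, 2}, ∅, {0, 1, 2}, ∅])
    (piece := pieceOfTable ![fun _ => (0, 123),
      ![(1, 123), (3, 123), (6, 2103), (1, 123)],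
      fun _ => (5, 123),
      ![(2, 3120), (4, 321), (7, 2130), (2, 3120)],
      fun _ => (8, 123)])
    (by decide +kernel)).symm

theorem stage4_portHomeo_stage5 : PortHomeo snappedBlockStage4 snappedBlockStage5 :=
  (portHomeo_of_stellarCheck (L := snappedBlockStage4Fine)
    (σ := ![∅, {0, 1}, {1, 2}, {0, 1}, ∅])
    (piece := pieceOfTable ![fun _ => (0, 123),
      ![(1, 123), (2, 123), (1, 123), (1, 123)],
      ![(3, 123), (3, 123), (4, 123), (3, 123)],
      ![(5, 123), (6, 123), (5, 123), (5, 123)],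
      fun _ => (7, 123)])
    (by decide +kernel)).trans
  (portHomeo_of_stellarCheck (L := snappedBlockStage4Fine)
    (σ := ![∅, {0, 2, 3}, {1, 2, 3}, ∅])
    (piece := pieceOfTable ![fun _ => (0, 123),
      ![(1, 123), (1, 123), (4, 123), (5, 3120)],
      ![(2, 123), (2, 123), (3, 2013), (6, 321)],
      fun _ => (7, 2013)])
    (by decide +kernel)).symm

theorem stage5_portHomeo_stage6 : PortHomeo snappedBlockStage5 snappedBlockStage6 :=
  (portHomeo_of_stellarCheck (L := snappedBlockStage5Fine)
    (σ := ![∅, ∅, {0, 1, 3}, {0, 1, 3}])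
    (piece := pieceOfTable ![fun _ => (0, 123),
      fun _ => (1, 123),
      ![(2, 123), (3, 123), (2, 123), (4, 123)],
      ![(5, 123), (6, 123), (5, 123), (7, 123)]])
    (by decide +kernel)).trans
  (portHomeo_of_stellarCheck (L := snappedBlockStage5Fine)
    (σ := ![∅, ∅, {1, 2}, {1, 2}, {2, 3}])
    (piece := pieceOfTable ![fun _ => (0, 123),
      fun _ => (1, 123),
      ![(3, 123), (3, 123), (6, 213), (3, 123)],
      ![(2, 1023), (2, 1023), (5, 1203), (2, 1023)],
      ![(7, 1032), (7, 1032), (7, 1032), (4, 1023)]])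
    (by decide +kernel)).symm

theorem stage6_portHomeo_stage7 : PortHomeo snappedBlockStage6 snappedBlockStage7 :=
  (portHomeo_of_stellarCheck (L := snappedBlockStage6Fine)
    (σ := ![∅, {0, 2}, ∅, {0, 2}, {0, 2}])
    (piece := pieceOfTable ![fun _ => (0, 123),
      ![(1, 123), (1, 123), (2, 123), (1, 123)],
      fun _ => (3, 123),
      ![(4, 123), (4, 123), (5, 123), (4, 123)],
      ![(6, 123), (6, 123), (7, 123), (6, 123)]])
    (by decide +kernel)).trans
  (portHomeo_of_stellarCheck (L := snappedBlockStage6Fine)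
    (σ := ![∅, {0, 1, 3}, ∅, {1, 2, 3}])
    (piece := pieceOfTable ![fun _ => (0, 123),
      ![(1, 123), (4, 1023), (1, 123), (6, 3120)],
      fun _ => (3, 123),
      ![(5, 213), (5, 213), (2, 123), (7, 132)]])
    (by decide +kernel)).symm

theorem stage7_portHomeo_snapped : PortHomeo snappedBlockStage7 snapped :=
  (portHomeo_of_stellarCheck (L := snappedBlockStage7)
    (σ := ![{0, 1, 2, 3}])
    (piece := pieceOfTable ![![(1, 3120), (2, 321), (3, 132), (0, 123)]])
    (by decide +kernel)).symm

/-- Bisecting the edge `23` cuts a snapped tetrahedron into two snapped tetrahedra in series. -/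
theorem snapped_glue_snapped : PortHomeo (snapped.glue snapped) snapped :=
  (portHomeo_of_stellarCheck (L := snapped.glue snapped) (σ := ![{2, 3}])
    (piece := ![![(Sum.inl 0, 1), (Sum.inl 0, 1), (Sum.inr 0, 1), (Sum.inl 0, 1)]])
    (by decide +kernel)).symm

theorem snapped_glue_block : PortHomeo (snapped.glue block) snapped :=
  (portHomeo_of_stellarCheck (L := snappedBlockStage0) (σ := fun _ => ∅)
    (piece := fun t _ => (finSumFinEquiv t, 1)) (by decide +kernel)).trans <|
  stage0_portHomeo_stage1.trans <|
  stage1_portHomeo_stage2.trans <|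
  stage2_portHomeo_stage3.trans <|
  stage3_portHomeo_stage4.trans <|
  stage4_portHomeo_stage5.trans <|
  stage5_portHomeo_stage6.trans <|
  stage6_portHomeo_stage7.trans stage7_portHomeo_snapped

end PortedComplex

end NormalSurface

/-! ### The closed snapped tetrahedron is the 3-sphere -/

namespace NormalSurface

open Equiv Complex

/-- The point of the plane with squared norm `a + b` that divides the circle in the ratio
`a : b`. -/
noncomputable def arcPoint (a b : ℝ) : ℂ :=
  (Real.sqrt (a + b) : ℂ) * exp ((2 * Real.pi * (a / (a + b)) : ℝ) * I)

theorem norm_arcPoint (a b : ℝ) : ‖arcPoint a b‖ = Real.sqrt (a + b) := by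
  rw [arcPoint, norm_mul, norm_exp_ofReal_mul_I, mul_one, norm_real,
    Real.norm_of_nonneg (Real.sqrt_nonneg _)]

theorem norm_arcPoint_sq {a b : ℝ} (ha : 0 ≤ a) (hb : 0 ≤ b) : ‖arcPoint a b‖ ^ 2 = a + b := by
  rw [norm_arcPoint, Real.sq_sqrt (add_nonneg ha hb)]

theorem continuous_arcPoint : Continuous fun x : ℝ × ℝ => arcPoint x.1 x.2 := by
  rw [continuous_iff_continuousAt]
  rintro ⟨a, b⟩
  by_cases h : a + b = 0
  -- Where `a + b = 0` the angle may jump, but the norm `√(a + b)` tends to zero.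
  · have h0 : arcPoint a b = 0 := by simp [arcPoint, h]
    rw [ContinuousAt]
    change Filter.Tendsto _ _ (nhds (arcPoint a b))
    rw [h0, tendsto_zero_iff_norm_tendsto_zero]
    simp only [norm_arcPoint]
    have : Continuous fun x : ℝ × ℝ => Real.sqrt (x.1 + x.2) := by fun_prop
    have := this.tendsto (a, b)
    simpa [h] using this
  · unfold arcPoint
    have : ContinuousAt (fun x : ℝ × ℝ => x.1 / (x.1 + x.2)) (a, b) :=
      ContinuousAt.div (by fun_prop) (by fun_prop) h
    fun_prop

theorem arcPoint_zero_left (b : ℝ) : arcPoint 0 b = (Real.sqrt b : ℂ) := by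
  simp [arcPoint]

theorem arcPoint_zero_right (a : ℝ) : arcPoint a 0 = (Real.sqrt a : ℂ) := by
  by_cases h : a = 0
  · simp [arcPoint, h]
  · simp [arcPoint, h, exp_two_pi_mul_I]

/-- Equal norms give equal sums, and then the angles differ by `n` full turns. Both ratios lie in
`[0, 1]`, so `|n| ≤ 1`, and `n = ±1` occurs only between the two ends of the interval. These are
exactly the points that a fold identifies. -/
theorem arcPoint_injective {a b a' b' : ℝ} (ha : 0 ≤ a) (hb : 0 ≤ b) (ha' : 0 ≤ a')
    (hb' : 0 ≤ b') (h : arcPoint a b = arcPoint a' b') :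
    (a = a' ∧ b = b') ∨ (a = 0 ∧ b' = 0 ∧ a' = b) ∨ (b = 0 ∧ a' = 0 ∧ b' = a) := by
  have hs : a + b = a' + b' := by
    rw [← norm_arcPoint_sq ha hb, ← norm_arcPoint_sq ha' hb', h]
  rcases (add_nonneg ha hb).eq_or_lt with h0 | h0
  · left; constructor <;> linarith
  · have hs0 : (Real.sqrt (a + b) : ℂ) ≠ 0 := by
      rw [ofReal_ne_zero]; exact (Real.sqrt_pos.2 h0).ne'
    rw [arcPoint, arcPoint, ← hs] at h
    have h := mul_left_cancel₀ hs0 h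
    rw [exp_eq_exp_iff_exists_int] at h
    obtain ⟨n, hn⟩ := h
    have hn : a / (a + b) = a' / (a + b) + n := by
      have hI : (2 * Real.pi * I : ℂ) ≠ 0 := by simp [Real.pi_ne_zero]
      have : ((a / (a + b) : ℝ) : ℂ) = ((a' / (a + b) + n : ℝ) : ℂ) := by
        apply mul_right_cancel₀ hI
        push_cast at hn ⊢
        linear_combination hn
      exact_mod_cast this
    have hn : a = a' + n * (a + b) := by
      field_simp at hn
      linarith
    have hn1 : n ≤ 1 := by
      by_contra hc
      have : (2 : ℝ) ≤ n := by exact_mod_cast (by omega : (2 : ℤ) ≤ n)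
      nlinarith
    have hn2 : -1 ≤ n := by
      by_contra hc
      have : (n : ℝ) ≤ -2 := by exact_mod_cast (by omega : n ≤ -2)
      nlinarith
    obtain rfl | rfl | rfl : n = 0 ∨ n = 1 ∨ n = -1 := by omega
    · left; push_cast at hn; constructor <;> linarith
    · right; right; push_cast at hn; refine ⟨?_, ?_, ?_⟩ <;> linarith
    · right; left; push_cast at hn; refine ⟨?_, ?_, ?_⟩ <;> linarith

theorem exists_arcPoint (z : ℂ) : ∃ a b : ℝ, 0 ≤ a ∧ 0 ≤ b ∧ a + b = ‖z‖ ^ 2 ∧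
    arcPoint a b = z := by
  by_cases h : z = 0
  · exact ⟨0, 0, le_rfl, le_rfl, by simp [h], by simp [arcPoint, h]⟩
  have hz : 0 < ‖z‖ := norm_pos_iff.2 h
  have hpi := Real.pi_pos
  have key : ∀ θ : ℝ, 0 ≤ θ → θ ≤ 1 → (‖z‖ : ℂ) * exp ((2 * Real.pi * θ : ℝ) * I) = z →
      ∃ a b : ℝ, 0 ≤ a ∧ 0 ≤ b ∧ a + b = ‖z‖ ^ 2 ∧ arcPoint a b = z := by
    intro θ h0 h1 hθ
    refine ⟨‖z‖ ^ 2 * θ, ‖z‖ ^ 2 * (1 - θ), by positivity, ?_, by ring, ?_⟩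
    · exact mul_nonneg (by positivity) (by linarith)
    · have hs : ‖z‖ ^ 2 * θ + ‖z‖ ^ 2 * (1 - θ) = ‖z‖ ^ 2 := by ring
      have hd : ‖z‖ ^ 2 * θ / ‖z‖ ^ 2 = θ := by field_simp
      rw [arcPoint, hs, Real.sqrt_sq hz.le, hd, hθ]
  by_cases harg : 0 ≤ arg z
  · refine key (arg z / (2 * Real.pi)) (by positivity) ?_ ?_
    · rw [div_le_one (by positivity)]
      linarith [arg_le_pi z]
    · rw [show 2 * Real.pi * (arg z / (2 * Real.pi)) = arg z by field_simp]
      exact norm_mul_exp_arg_mul_I z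
  -- A negative argument is moved by one full turn, so that the ratio lies in `[0, 1]`.
  · refine key (arg z / (2 * Real.pi) + 1) ?_ ?_ ?_
    · have : -1 ≤ arg z / (2 * Real.pi) := by
        rw [le_div_iff₀ (by positivity)]
        linarith [neg_pi_lt_arg z]
      linarith
    · have : arg z / (2 * Real.pi) ≤ 0 :=
        div_nonpos_of_nonpos_of_nonneg (by linarith) (by positivity)
      linarith
    · rw [show 2 * Real.pi * (arg z / (2 * Real.pi) + 1) = arg z + 2 * Real.pi by field_simp]
      push_cast
      rw [add_mul, exp_add, exp_two_pi_mul_I, mul_one]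
      exact norm_mul_exp_arg_mul_I z

/-- Four-dimensional Euclidean space, as the product of two planes. -/
abbrev TwoPlanes : Type := WithLp 2 (ℂ × ℂ)

instance : Fact (Module.finrank ℝ TwoPlanes = 3 + 1) :=
  ⟨by
    rw [(WithLp.linearEquiv 2 ℝ (ℂ × ℂ)).finrank_eq, Module.finrank_prod, finrank_real_complex]⟩

/-- The three-dimensional sphere. -/
abbrev ThreeSphere : Type := Metric.sphere (0 : TwoPlanes) 1

theorem mem_threeSphere (z w : ℂ) : WithLp.toLp 2 (z, w) ∈ Metric.sphere (0 : TwoPlanes) 1 ↔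
    ‖z‖ ^ 2 + ‖w‖ ^ 2 = 1 := by
  rw [mem_sphere_zero_iff_norm, ← sq_eq_sq₀ (norm_nonneg _) zero_le_one, one_pow,
    WithLp.prod_norm_sq_eq_of_L2]
  rfl

/-- The map of the tetrahedron to the three-sphere that takes the edges `01` and `23` to the two
coordinate circles, wrapping each of them once around its circle. -/
noncomputable def toThreeSphere (p : Tet) : ThreeSphere :=
  ⟨WithLp.toLp 2 (arcPoint (p.1 0) (p.1 1), arcPoint (p.1 2) (p.1 3)), by
    rw [mem_threeSphere, norm_arcPoint_sq (p.2.1 0) (p.2.1 1),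
      norm_arcPoint_sq (p.2.1 2) (p.2.1 3), ← p.2.2, Fin.sum_univ_four]
    ring⟩

theorem continuous_toThreeSphere : Continuous toThreeSphere := by
  have h (j : Fin 4) : Continuous fun q : Tet => q.1 j :=
    (continuous_apply j).comp continuous_subtype_val
  refine Continuous.subtype_mk
    ((WithLp.prod_continuous_toLp 2 ℂ ℂ).comp (Continuous.prodMk ?_ ?_)) _
  · exact continuous_arcPoint.comp ((h 0).prodMk (h 1))
  · exact continuous_arcPoint.comp ((h 2).prodMk (h 3))

theorem toThreeSphere_surjective : Function.Surjective toThreeSphere := by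
  rintro ⟨x, hx⟩
  obtain ⟨a, b, ha, hb, hab, hz⟩ := exists_arcPoint x.fst
  obtain ⟨c, d, hc, hd, hcd, hw⟩ := exists_arcPoint x.snd
  have h1 : ‖x.fst‖ ^ 2 + ‖x.snd‖ ^ 2 = 1 := (mem_threeSphere x.fst x.snd).1 hx
  refine ⟨⟨![a, b, c, d], fun j => ?_, ?_⟩, ?_⟩
  · fin_cases j <;> assumption
  · rw [Fin.sum_univ_four]
    simp
    linarith
  · apply Subtype.ext
    simp [toThreeSphere, hz, hw]
    rfl

namespace PortedComplex

section

attribute [local instance] sumDecidableEq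

theorem snapped_adj (t : Fin 1) (f : Fin 4) : snapped.adj t f =
    (![Sum.inl (0, swap 0 1), Sum.inl (0, swap 0 1), Sum.inr (true, swap 2 3),
      Sum.inr (false, 1)] : Fin 4 → (Fin 1 × Perm (Fin 4)) ⊕ (Bool × Perm (Fin 4))) f := by
  revert t f
  decide +kernel

theorem snapped_port (k : Bool) : snapped.port k = (0, if k then swap 2 3 else 1) := by
  revert k
  decide +kernel

theorem block_adj (t f : Fin 4) : block.adj t f =
    (![![Sum.inl (0, swap 0 3), Sum.inl (1, 1), Sum.inr (false, swap 2 3), Sum.inl (0, swap 0 3)],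
      ![Sum.inl (2, 1), Sum.inl (0, 1), Sum.inl (3, 1), Sum.inl (3, 1)],
      ![Sum.inl (1, 1), Sum.inl (2, swap 1 3), Sum.inr (true, swap 2 3 * swap 0 3),
        Sum.inl (2, swap 1 3)],
      ![Sum.inl (3, swap 0 1), Sum.inl (3, swap 0 1), Sum.inl (1, 1), Sum.inl (1, 1)]] :
      Fin 4 → Fin 4 → (Fin 4 × Perm (Fin 4)) ⊕ (Bool × Perm (Fin 4))) t f := by
  revert t f
  decide +kernel

theorem block_port (k : Bool) :
    block.port k = if k then (2, swap 0 3 * swap 2 3) else (0, swap 2 3) := by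
  revert k
  decide +kernel

end

theorem close_snapped_adj (f : Fin 4) : snapped.close.adj 0 f =
    Sum.inl (0, (![swap 0 1, swap 0 1, swap 2 3, swap 2 3] : Fin 4 → Perm (Fin 4)) f) := by
  fin_cases f <;> simp [close, snapped_adj, snapped_port]

/-- The map of a single tetrahedron, with its faces folded together in pairs, to the sphere. -/
noncomputable def closeSnappedMap : snapped.close.Space → ThreeSphere :=
  snapped.close.lift (fun _ p => toThreeSphere p) (by
    intro t f t' g hadj p hp
    obtain rfl := Subsingleton.elim t 0
    rw [close_snapped_adj] at hadj
    apply Subtype.ext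
    fin_cases f <;> simp at hadj hp <;> rw [← hadj.2] <;>
      simp [toThreeSphere, hp, swap_apply_of_ne_of_ne, arcPoint_zero_left, arcPoint_zero_right])

/-- By `arcPoint_injective` the two pairs of coordinates are equal or are interchanged by the fold.
The fold leaves the other two coordinates alone, so the folds along the two edges can be used one
after the other. -/
theorem exists_pt_eq_of_fold {i j : Fin 4}
    (hi : snapped.close.adj 0 i = Sum.inl (0, swap i j))
    (hj : snapped.close.adj 0 j = Sum.inl (0, swap i j)) {p q : Tet}
    (h : arcPoint (p.1 i) (p.1 j) = arcPoint (q.1 i) (q.1 j)) :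
    ∃ p' : Tet, snapped.close.pt 0 p = snapped.close.pt 0 p' ∧ p'.1 i = q.1 i ∧ p'.1 j = q.1 j ∧
      ∀ k, k ≠ i → k ≠ j → p'.1 k = p.1 k := by
  rcases arcPoint_injective (p.2.1 i) (p.2.1 j) (q.2.1 i) (q.2.1 j) h with h | h | h
  · exact ⟨p, rfl, h.1, h.2, fun _ _ _ => rfl⟩
  · refine ⟨_, pt_eq_pt _ hi h.1, ?_, ?_, fun k hki hkj => ?_⟩
    · simp [h]
    · simp [h]
    · simp [swap_apply_of_ne_of_ne hki hkj]
  · refine ⟨_, pt_eq_pt _ hj h.1, ?_, ?_, fun k hki hkj => ?_⟩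
    · simp [h]
    · simp [h]
    · simp [swap_apply_of_ne_of_ne hki hkj]

theorem closeSnappedMap_injective : Function.Injective closeSnappedMap := by
  intro x y hxy
  induction x using snapped.close.ind with
  | h t p =>
  induction y using snapped.close.ind with
  | h t' q =>
  obtain rfl := Subsingleton.elim t 0
  obtain rfl := Subsingleton.elim t' 0
  have h : toThreeSphere p = toThreeSphere q := hxy
  have h := congrArg Subtype.val h
  have h1 : arcPoint (p.1 0) (p.1 1) = arcPoint (q.1 0) (q.1 1) := congrArg WithLp.fst h
  have h2 : arcPoint (p.1 2) (p.1 3) = arcPoint (q.1 2) (q.1 3) := congrArg WithLp.snd h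
  obtain ⟨p', hp', h0', h1', hk'⟩ := exists_pt_eq_of_fold (close_snapped_adj 0)
    (close_snapped_adj 1) h1
  rw [← hk' 2 (by decide) (by decide), ← hk' 3 (by decide) (by decide)] at h2
  obtain ⟨r, hr, h2', h3', hr'⟩ := exists_pt_eq_of_fold (close_snapped_adj 2)
    (close_snapped_adj 3) h2
  rw [hp', hr]
  congr 1
  ext k
  change r.1 k = q.1 k
  fin_cases k
  · exact (hr' 0 (by decide) (by decide)).trans h0'
  · exact (hr' 1 (by decide) (by decide)).trans h1'
  · exact h2'
  · exact h3'

instance {ι : Type} [TopologicalSpace ι] [Finite ι] (K : PortedComplex ι) : CompactSpace K.Space :=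
  inferInstanceAs (CompactSpace (Quot K.Identified))

/-- The single tetrahedron with its faces folded together in pairs is a three-sphere. -/
theorem close_snapped_homeo : Nonempty (snapped.close.Space ≃ₜ ThreeSphere) := by
  have hc : Continuous closeSnappedMap :=
    continuous_lift _ _ _ fun _ => continuous_toThreeSphere
  have hb : Function.Bijective closeSnappedMap := by
    refine ⟨closeSnappedMap_injective, fun x => ?_⟩
    obtain ⟨p, hp⟩ := toThreeSphere_surjective x
    exact ⟨snapped.close.pt 0 p, hp⟩
  exact ⟨Continuous.homeoOfEquivCompactToT2 (f := Equiv.ofBijective _ hb) hc⟩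

end PortedComplex

theorem exists_openPartialHomeomorph_threeSphere (x : ThreeSphere) :
    ∃ e : OpenPartialHomeomorph ThreeSphere (EuclideanSpace ℝ (Fin 3)), x ∈ e.source :=
  ⟨chartAt (EuclideanSpace ℝ (Fin 3)) x, mem_chart_source _ x⟩

theorem connectedSpace_threeSphere : ConnectedSpace ThreeSphere := by
  have : PathConnectedSpace Tet :=
    isPathConnected_iff_pathConnectedSpace.1
      ((convex_stdSimplex ℝ (Fin 4)).isPathConnected ⟨_, single_mem_stdSimplex ℝ 0⟩)
  exact toThreeSphere_surjective.connectedSpace continuous_toThreeSphere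

/-- A triangulation whose space is a three-sphere is a closed 3-manifold triangulation. -/
theorem Gluing.isClosedThreeManifold_of_homeo {n : ℕ} (T : Gluing n) (e : T.Space ≃ₜ ThreeSphere) :
    T.IsClosedThreeManifold where
  connected := by
    have := connectedSpace_threeSphere
    exact e.symm.surjective.connectedSpace e.symm.continuous
  hausdorff := e.isEmbedding.t2Space
  secondCountable := e.secondCountableTopology
  locallyEuclidean x := by
    obtain ⟨c, hc⟩ := exists_openPartialHomeomorph_threeSphere (e x)
    exact ⟨e.transOpenPartialHomeomorph c, by simpa using hc⟩

/-! ### From complexes with ports to closed 3-manifold triangulations -/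

namespace PortedComplex

variable {ι κ : Type}

/-- Every face of the complex is either glued to another face, with inverse gluing maps, or is a
port. -/
structure IsRegular (K : PortedComplex ι) : Prop where
  portLaw : K.PortLaw
  adj_adj : ∀ t f t' g, K.adj t f = Sum.inl (t', g) → K.adj t' (g f) = Sum.inl (t, g⁻¹)
  ne_self : ∀ t f t' g, K.adj t f = Sum.inl (t', g) → (t', g f) ≠ (t, f)

theorem isRegular_of_check (K : PortedComplex ι)
    (h : ∀ t f, match K.adj t f with
      | Sum.inl x => K.adj x.1 (x.2 f) = Sum.inl (t, x.2⁻¹) ∧ (x.1, x.2 f) ≠ (t, f)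
      | Sum.inr x => x.2 f = 3 ∧ K.port x.1 = (t, x.2⁻¹))
    (h' : ∀ k, K.adj (K.port k).1 ((K.port k).2 3) = Sum.inr (k, (K.port k).2⁻¹)) :
    K.IsRegular where
  portLaw := ⟨fun t f k π hadj => by have := h t f; rwa [hadj] at this, h'⟩
  adj_adj t f t' g hadj := by
    have := h t f
    rw [hadj] at this
    exact this.1
  ne_self t f t' g hadj := by
    have := h t f
    rw [hadj] at this
    exact this.2

theorem isRegular_snapped : snapped.IsRegular := by
  refine isRegular_of_check _ (fun t f => ?_) fun k => ?_
  · rw [snapped_adj]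
    obtain rfl := Subsingleton.elim t 0
    fin_cases f <;> simp [snapped_adj, snapped_port]
  · cases k <;> simp [snapped_adj, snapped_port]

theorem isRegular_block : block.IsRegular := by
  refine isRegular_of_check _ (fun t f => ?_) fun k => ?_
  · rw [block_adj]
    fin_cases t <;> fin_cases f <;> simp [block_adj, block_port]
    all_goals decide
  · cases k <;> simp [block_adj, block_port, swap_apply_of_ne_of_ne]

theorem IsRegular.glue {K : PortedComplex ι} {L : PortedComplex κ} (hK : K.IsRegular)
    (hL : L.IsRegular) : (K.glue L).IsRegular where
  portLaw := glue_portLaw hK.portLaw hL.portLaw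
  adj_adj := by
    rintro (t | t) f t' g h
    · rcases hadj : K.adj t f with ⟨t'', g'⟩ | ⟨_ | _, ρ⟩ <;> simp [PortedComplex.glue, hadj] at h
      · obtain ⟨rfl, rfl⟩ := h
        simp [PortedComplex.glue, hK.adj_adj _ _ _ _ hadj]
      · obtain ⟨rfl, rfl⟩ := h
        obtain ⟨h1, h2⟩ := hK.portLaw.1 _ _ _ _ hadj
        simp [PortedComplex.glue, h1, h2, hL.portLaw.2 false]
    · rcases hadj : L.adj t f with ⟨t'', g'⟩ | ⟨_ | _, ρ⟩ <;> simp [PortedComplex.glue, hadj] at h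
      · obtain ⟨rfl, rfl⟩ := h
        simp [PortedComplex.glue, hL.adj_adj _ _ _ _ hadj]
      · obtain ⟨rfl, rfl⟩ := h
        obtain ⟨h1, h2⟩ := hL.portLaw.1 _ _ _ _ hadj
        simp [PortedComplex.glue, h1, h2, hK.portLaw.2 true]
  ne_self := by
    rintro (t | t) f t' g h
    · rcases hadj : K.adj t f with ⟨t'', g'⟩ | ⟨_ | _, ρ⟩ <;> simp [PortedComplex.glue, hadj] at h
      · obtain ⟨rfl, rfl⟩ := h
        simpa using hK.ne_self _ _ _ _ hadj
      · obtain ⟨rfl, rfl⟩ := h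
        simp
    · rcases hadj : L.adj t f with ⟨t'', g'⟩ | ⟨_ | _, ρ⟩ <;> simp [PortedComplex.glue, hadj] at h
      · obtain ⟨rfl, rfl⟩ := h
        simpa using hL.ne_self _ _ _ _ hadj
      · obtain ⟨rfl, rfl⟩ := h
        simp

/-- The face to which a face is glued when the two ports are glued to each other. -/
def closeAdj (K : PortedComplex ι) (t : ι) (f : Fin 4) : ι × Perm (Fin 4) :=
  match K.adj t f with
  | Sum.inl x => x
  | Sum.inr (k, π) => ((K.port (!k)).1, (K.port (!k)).2 * π)

theorem close_adj (K : PortedComplex ι) (t : ι) (f : Fin 4) :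
    K.close.adj t f = Sum.inl (K.closeAdj t f) := by
  rcases h : K.adj t f with x | x <;> simp [close, closeAdj, h]

theorem IsRegular.closeAdj_closeAdj {K : PortedComplex ι} (hK : K.IsRegular) (t : ι) (f : Fin 4) :
    K.closeAdj (K.closeAdj t f).1 ((K.closeAdj t f).2 f) = (t, (K.closeAdj t f).2⁻¹) := by
  rcases h : K.adj t f with ⟨t', g⟩ | ⟨k, π⟩
  · simp [closeAdj, h, hK.adj_adj _ _ _ _ h]
  · obtain ⟨h1, h2⟩ := hK.portLaw.1 _ _ _ _ h
    simp [closeAdj, h, h1, hK.portLaw.2, h2]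

theorem IsRegular.closeAdj_ne {K : PortedComplex ι} (hK : K.IsRegular) (t : ι) (f : Fin 4) :
    ((K.closeAdj t f).1, (K.closeAdj t f).2 f) ≠ (t, f) := by
  rcases h : K.adj t f with ⟨t', g⟩ | ⟨k, π⟩
  · simpa [closeAdj, h] using hK.ne_self _ _ _ _ h
  · obtain ⟨h1, h2⟩ := hK.portLaw.1 _ _ _ _ h
    -- Port `k` is glued to port `!k`, and one face cannot carry both labels.
    have h3 := hK.portLaw.2 (!k)
    simp only [closeAdj, h, Perm.mul_apply, h1]
    intro he
    rw [Prod.mk.injEq] at he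
    rw [he.1, he.2, h] at h3
    simp at h3

/-- The triangulation given by a complex whose ports are glued to each other. -/
def toGluing {n : ℕ} {K : PortedComplex ι} (hK : K.IsRegular) (e : ι ≃ Fin n) : Gluing n where
  adj t f := e (K.closeAdj (e.symm t) f).1
  glue t f := (K.closeAdj (e.symm t) f).2
  adj_adj t f := by simp [hK.closeAdj_closeAdj]
  glue_glue t f := by simp [hK.closeAdj_closeAdj]
  ne_self t f h := hK.closeAdj_ne (e.symm t) f (by
    rw [Prod.mk.injEq] at h ⊢
    exact ⟨e.eq_symm_apply.2 h.1, h.2⟩)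

theorem toGluing_identified {n : ℕ} {K : PortedComplex ι} (hK : K.IsRegular) (e : ι ≃ Fin n)
    (p q : Fin n × Tet) : (toGluing hK e).Identified p q ↔
      K.close.Identified (e.symm p.1, p.2) (e.symm q.1, q.2) := by
  have key (g : Perm (Fin 4)) : (∀ v, q.2.1 (g v) = p.2.1 v) ↔ q.2 = Tet.permute g p.2 := by
    constructor
    · intro h
      ext v
      change q.2.1 v = p.2.1 (g⁻¹ v)
      rw [← h]
      simp
    · intro h v
      simp [h]
  constructor
  · rintro ⟨f, hp, hq, h⟩
    refine ⟨f, (K.closeAdj (e.symm p.1) f).2, ?_, hp, (key _).1 h⟩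
    rw [close_adj, hq]
    simp [toGluing]
  · rintro ⟨f, g, hadj, hp, h⟩
    rw [close_adj] at hadj
    have hadj := Sum.inl_injective hadj
    dsimp only at hadj h
    refine ⟨f, hp, ?_, (key _).2 ?_⟩
    · simp [toGluing, hadj]
    · simp [toGluing, hadj, h]

theorem nonempty_toGluing_homeo [TopologicalSpace ι] [DiscreteTopology ι] {n : ℕ}
    {K : PortedComplex ι} (hK : K.IsRegular) (e : ι ≃ Fin n) :
    Nonempty ((toGluing hK e).Space ≃ₜ K.close.Space) := by
  have h1 : ∀ p q, (toGluing hK e).Identified p q →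
      K.close.Identified (e.symm p.1, p.2) (e.symm q.1, q.2) := fun p q =>
    (toGluing_identified hK e p q).1
  have h2 : ∀ p q, K.close.Identified p q →
      (toGluing hK e).Identified (e p.1, p.2) (e q.1, q.2) := fun p q h => by
    rw [toGluing_identified]
    simpa using h
  have hc : Continuous e := continuous_of_discreteTopology
  have hc' : Continuous e.symm := continuous_of_discreteTopology
  refine ⟨⟨⟨Quot.map _ h1, Quot.map _ h2, ?_, ?_⟩, ?_, ?_⟩⟩
  · rintro ⟨p⟩
    simp [Quot.map]
    rfl
  · rintro ⟨p⟩
    simp [Quot.map]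
    rfl
  · exact continuous_quot_lift _ ((continuous_quot_mk (r := K.close.Identified)).comp (by fun_prop))
  · exact continuous_quot_lift _
      ((continuous_quot_mk (r := (toGluing hK e).Identified)).comp (by fun_prop))

theorem isClosedThreeManifold_toGluing [TopologicalSpace ι] [DiscreteTopology ι] {n : ℕ}
    {K : PortedComplex ι} (hK : K.IsRegular) (h : PortHomeo K snapped) (e : ι ≃ Fin n) :
    (toGluing hK e).IsClosedThreeManifold := by
  obtain ⟨a⟩ := nonempty_toGluing_homeo hK e
  obtain ⟨b⟩ := h.close hK.portLaw isRegular_snapped.portLaw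
  obtain ⟨c⟩ := close_snapped_homeo
  exact Gluing.isClosedThreeManifold_of_homeo _ (a.trans (b.trans c))

end PortedComplex

/-! ### Normal surfaces in chains of balls -/

/-- The number of arcs on the face `f` of a tetrahedron that cut off the vertex `v`. -/
def arc {R : Type*} [Add R] (y : Fin 4 ⊕ Fin 3 → R) (f v : Fin 4) : R :=
  y (Sum.inl v) + y (Sum.inr (quadType v f))

namespace PortedComplex

variable {ι κ : Type}

/-- The matching equations of a complex, at the faces other than its ports. -/
def Matches {R : Type*} [Add R] (K : PortedComplex ι) (y : ι → Fin 4 ⊕ Fin 3 → R) : Prop :=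
  ∀ t f t' g, K.adj t f = Sum.inl (t', g) → ∀ v, v ≠ f → arc (y t) f v = arc (y t') (g f) (g v)

/-- The number of arcs on a port that cut off its vertex `v`. -/
def portArc {R : Type*} [Add R] (K : PortedComplex ι) (y : ι → Fin 4 ⊕ Fin 3 → R) (k : Bool)
    (v : Fin 4) : R :=
  arc (y (K.port k).1) ((K.port k).2 3) ((K.port k).2 v)

/-- The only new equations are those at the seam. In the port labels they compare arc counts at `0`,
`1`, `2`; the label `3` belongs to the vertex opposite the port. -/
theorem matches_glue {K : PortedComplex ι} {L : PortedComplex κ} (hK : K.IsRegular)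
    (hL : L.IsRegular) {y : ι ⊕ κ → Fin 4 ⊕ Fin 3 → ℝ} :
    (K.glue L).Matches y ↔ K.Matches (y ∘ Sum.inl) ∧ L.Matches (y ∘ Sum.inr) ∧
      ∀ v, v ≠ 3 → K.portArc (y ∘ Sum.inl) true v = L.portArc (y ∘ Sum.inr) false v := by
  constructor
  · intro h
    refine ⟨fun t f t' g hadj v hv => ?_, fun t f t' g hadj v hv => ?_, fun v hv => ?_⟩
    · exact h (Sum.inl t) f (Sum.inl t') g (by simp [glue, hadj]) v hv
    · exact h (Sum.inr t) f (Sum.inr t') g (by simp [glue, hadj]) v hv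
    · have := h (Sum.inl (K.port true).1) ((K.port true).2 3) (Sum.inr (L.port false).1)
        ((L.port false).2 * (K.port true).2⁻¹) (by simp [glue, hK.portLaw.2 true])
        ((K.port true).2 v) (by simpa using hv)
      simpa [portArc] using this
  · rintro ⟨h1, h2, h3⟩ (t | t) f t' g h v hv
    · rcases hadj : K.adj t f with ⟨t'', g'⟩ | ⟨_ | _, ρ⟩ <;> simp [glue, hadj] at h
      · obtain ⟨rfl, rfl⟩ := h
        exact h1 t f t'' g' hadj v hv
      · obtain ⟨rfl, rfl⟩ := h
        obtain ⟨h4, h5⟩ := hK.portLaw.1 _ _ _ _ hadj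
        have := h3 (ρ v) (by rw [← h4]; simpa using hv)
        simpa [portArc, h5, ← h4] using this
    · rcases hadj : L.adj t f with ⟨t'', g'⟩ | ⟨_ | _, ρ⟩ <;> simp [glue, hadj] at h
      · obtain ⟨rfl, rfl⟩ := h
        exact h2 t f t'' g' hadj v hv
      · obtain ⟨rfl, rfl⟩ := h
        obtain ⟨h4, h5⟩ := hL.portLaw.1 _ _ _ _ hadj
        have := h3 (ρ v) (by rw [← h4]; simpa using hv)
        simpa [portArc, h5, ← h4] using this.symm

theorem matches_close {K : PortedComplex ι} (hK : K.IsRegular) {y : ι → Fin 4 ⊕ Fin 3 → ℝ} :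
    K.close.Matches y ↔ K.Matches y ∧ ∀ v, v ≠ 3 → K.portArc y true v = K.portArc y false v := by
  constructor
  · intro h
    refine ⟨fun t f t' g hadj v hv => ?_, fun v hv => ?_⟩
    · exact h t f t' g (by simp [close, hadj]) v hv
    · have := h (K.port true).1 ((K.port true).2 3) (K.port false).1
        ((K.port false).2 * (K.port true).2⁻¹) (by simp [close, hK.portLaw.2 true])
        ((K.port true).2 v) (by simpa using hv)
      simpa [portArc] using this
  · rintro ⟨h1, h2⟩ t f t' g h v hv
    rcases hadj : K.adj t f with ⟨t'', g'⟩ | ⟨k, ρ⟩ <;> simp [close, hadj] at h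
    · obtain ⟨rfl, rfl⟩ := h
      exact h1 t f t'' g' hadj v hv
    · obtain ⟨rfl, rfl⟩ := h
      obtain ⟨h4, h5⟩ := hK.portLaw.1 _ _ _ _ hadj
      have := h2 (ρ v) (by rw [← h4]; simpa using hv)
      cases k
      · simpa [portArc, h5, ← h4] using this.symm
      · simpa [portArc, h5, ← h4] using this

/-- The support of `y` is contained in that of `x`. -/
def SuppLE (y x : ι → Fin 4 ⊕ Fin 3 → ℝ) : Prop := ∀ t d, x t d = 0 → y t d = 0

/-- A normal surface, with at most one type of quadrilaterals in each tetrahedron, each of whose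
ports contains one arc around every vertex. -/
structure IsUnitSurface (K : PortedComplex ι) (x : ι → Fin 4 ⊕ Fin 3 → ℝ) : Prop where
  nonneg : ∀ t d, 0 ≤ x t d
  quad : ∀ t i j, x t (Sum.inr i) ≠ 0 → x t (Sum.inr j) ≠ 0 → i = j
  isMatching : K.Matches x
  portArc_eq_one : ∀ k v, v ≠ 3 → K.portArc x k v = 1

/-- The unit surface `x` is determined by its support up to a factor, among the solutions of the
matching equations with equal numbers of arcs around the vertices `0` and `2` of the second
port. -/
structure IsRay (K : PortedComplex ι) (x : ι → Fin 4 ⊕ Fin 3 → ℝ) : Prop extends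
    K.IsUnitSurface x where
  unique : ∀ y, K.Matches y → SuppLE y x → K.portArc y true 0 = K.portArc y true 2 →
    ∀ t d, y t d = K.portArc y true 0 * x t d

/-- The unit surface `x` is determined by its support up to a factor, among the solutions of the
matching equations with equal numbers of arcs around the vertices of each port. Moreover, such
an equality for the second port gives one for the first port. -/
structure IsCellRay (K : PortedComplex ι) (x : ι → Fin 4 ⊕ Fin 3 → ℝ) : Prop extends
    K.IsUnitSurface x where
  unique : ∀ y, K.Matches y → SuppLE y x → (∀ k v, v ≠ 3 → K.portArc y k v = K.portArc y k 0) →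
    ∀ t d, y t d = K.portArc y true 0 * x t d
  back : ∀ y, K.Matches y → SuppLE y x → K.portArc y true 0 = K.portArc y true 2 →
    K.portArc y false 0 = K.portArc y false 2

/-- On the second port, the arcs that cut off the vertices `0` and `1` are in equal number. -/
def IsFolded (K : PortedComplex ι) : Prop :=
  ∀ y : ι → Fin 4 ⊕ Fin 3 → ℝ, K.Matches y → K.portArc y true 0 = K.portArc y true 1

theorem portArc_mul {K : PortedComplex ι} {x y : ι → Fin 4 ⊕ Fin 3 → ℝ} {c : ℝ}
    (h : ∀ t d, y t d = c * x t d) (k : Bool) (v : Fin 4) :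
    K.portArc y k v = c * K.portArc x k v := by
  simp only [portArc, arc, h]
  ring

/-- The fold exchanges the vertices `0` and `1`, hence the quadrilateral types `1` and `2`. It fixes
type `0` and the triangles at `2` and `3`, which therefore remain unconstrained. -/
theorem matches_snapped {y : Fin 1 → Fin 4 ⊕ Fin 3 → ℝ} : snapped.Matches y ↔
    y 0 (Sum.inl 0) = y 0 (Sum.inl 1) ∧ y 0 (Sum.inr 1) = y 0 (Sum.inr 2) := by
  constructor
  · intro h
    have h1 := h 0 0 0 (swap 0 1) (by simp [snapped_adj]) 1 (by decide)
    have h2 := h 0 0 0 (swap 0 1) (by simp [snapped_adj]) 2 (by decide)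
    simp [arc, quadType, swap_apply_of_ne_of_ne] at h1 h2
    exact ⟨h1.symm, h2⟩
  · rintro ⟨h1, h2⟩ t f t' g hadj v hv
    obtain rfl := Subsingleton.elim t 0
    obtain rfl := Subsingleton.elim t' 0
    rw [snapped_adj] at hadj
    fin_cases f <;> simp at hadj <;> subst hadj <;> fin_cases v <;>
      simp [arc, quadType, swap_apply_of_ne_of_ne, h1, h2] at hv ⊢

/-- The normal quadrilateral that separates the edges `01` and `23` of the snapped tetrahedron,
with the triangles at `0` and `1`. -/
def snappedRay (_ : Fin 1) : Fin 4 ⊕ Fin 3 → ℝ := Sum.elim ![1, 1, 0, 0] ![1, 0, 0]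

theorem portArc_snapped (y : Fin 1 → Fin 4 ⊕ Fin 3 → ℝ) (k : Bool) :
    snapped.portArc y k 0 = y 0 (Sum.inl 0) + y 0 (Sum.inr (if k then 1 else 2)) ∧
    snapped.portArc y k 1 = y 0 (Sum.inl 1) + y 0 (Sum.inr (if k then 2 else 1)) ∧
    snapped.portArc y k 2 = y 0 (Sum.inl (if k then 3 else 2)) + y 0 (Sum.inr 0) := by
  cases k <;> simp [portArc, snapped_port, arc, quadType, swap_apply_of_ne_of_ne]

theorem isFolded_snapped : snapped.IsFolded := by
  intro y hy
  obtain ⟨h0, h1, h2⟩ := portArc_snapped y true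
  obtain ⟨h3, h4⟩ := matches_snapped.1 hy
  rw [h0, h1, h3]
  simp [h4]

theorem forall_ne_three {P : Fin 4 → Prop} : (∀ v, v ≠ 3 → P v) ↔ P 0 ∧ P 1 ∧ P 2 := by
  constructor
  · intro h
    exact ⟨h 0 (by decide), h 1 (by decide), h 2 (by decide)⟩
  · rintro ⟨h0, h1, h2⟩ v hv
    fin_cases v
    exacts [h0, h1, h2, absurd rfl hv]

/-- Only the triangles at `0` and `1` and the quadrilaterals of type `0` survive, and each of these
meets both ports in an arc around the same label. -/
theorem portArc_snapped_eq {y : Fin 1 → Fin 4 ⊕ Fin 3 → ℝ} (hy : SuppLE y snappedRay)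
    (v : Fin 4) (hv : v ≠ 3) : snapped.portArc y true v = snapped.portArc y false v := by
  have h2 := hy 0 (Sum.inl 2) rfl
  have h3 := hy 0 (Sum.inl 3) rfl
  have h5 := hy 0 (Sum.inr 1) rfl
  have h6 := hy 0 (Sum.inr 2) rfl
  revert v
  rw [forall_ne_three]
  simp [portArc_snapped, h2, h3, h5, h6]

theorem isRay_snappedRay : snapped.IsRay snappedRay where
  nonneg t d := by
    rcases d with d | d <;> fin_cases d <;> simp [snappedRay]
  quad t i j := by
    fin_cases i <;> fin_cases j <;> simp [snappedRay]
  isMatching := matches_snapped.2 (by simp [snappedRay])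
  portArc_eq_one k := by
    rw [forall_ne_three]
    cases k <;> simp [portArc_snapped, snappedRay]
  unique y hy hsupp h t d := by
    have h2 := hsupp 0 (Sum.inl 2) rfl
    have h3 := hsupp 0 (Sum.inl 3) rfl
    have h5 := hsupp 0 (Sum.inr 1) rfl
    have h6 := hsupp 0 (Sum.inr 2) rfl
    have h0 := (matches_snapped.1 hy).1
    obtain rfl := Subsingleton.elim t 0
    obtain ⟨p0, -, p2⟩ := portArc_snapped y true
    rw [p0, p2] at h
    simp [h3, h5] at h
    rw [p0]
    rcases d with d | d <;> fin_cases d <;> simp [snappedRay, h2, h3, h5, h6, ← h0, ← h]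

theorem isCellRay_snappedRay : snapped.IsCellRay snappedRay where
  toIsUnitSurface := isRay_snappedRay.toIsUnitSurface
  unique y hy hsupp h := isRay_snappedRay.unique y hy hsupp (h true 2 (by decide)).symm
  back y _ hsupp h := by
    rwa [← portArc_snapped_eq hsupp 0 (by decide), ← portArc_snapped_eq hsupp 2 (by decide)]

theorem IsFolded.glue {K : PortedComplex ι} {L : PortedComplex κ} (hK : K.IsRegular)
    (hL : L.IsRegular) (h : L.IsFolded) : (K.glue L).IsFolded :=
  fun _ hy => h _ ((matches_glue hK hL).1 hy).2.1

/-- Equality at `0` and `2` on the last port passes back through `L` by `back`, which makes the ray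
property of `K` applicable. The folds of `K` and `L` add equality at `0` and `1` on both ports of
`L`, so `L` contributes a multiple of `z`. -/
theorem IsRay.glue {K : PortedComplex ι} {L : PortedComplex κ} (hK : K.IsRegular)
    (hL : L.IsRegular) (hKF : K.IsFolded) (hLF : L.IsFolded) {x : ι → Fin 4 ⊕ Fin 3 → ℝ}
    {z : κ → Fin 4 ⊕ Fin 3 → ℝ} (hx : K.IsRay x) (hz : L.IsCellRay z) :
    (K.glue L).IsRay (Sum.elim x z) where
  nonneg := by
    rintro (t | t) d
    exacts [hx.nonneg t d, hz.nonneg t d]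
  quad := by
    rintro (t | t)
    exacts [hx.quad t, hz.quad t]
  isMatching := (matches_glue hK hL).2 ⟨hx.isMatching, hz.isMatching, fun v hv =>
    (hx.portArc_eq_one true v hv).trans (hz.portArc_eq_one false v hv).symm⟩
  portArc_eq_one k v hv := by
    cases k
    exacts [hx.portArc_eq_one false v hv, hz.portArc_eq_one true v hv]
  unique y hy hsupp h := by
    obtain ⟨h1, h2, h3⟩ := (matches_glue hK hL).1 hy
    obtain ⟨e0, e1, e2⟩ := forall_ne_three.1 h3
    have h4 : L.portArc (y ∘ Sum.inr) true 0 = L.portArc (y ∘ Sum.inr) true 2 := h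
    have h5 := hz.back _ h2 (fun t d => hsupp (Sum.inr t) d) h4
    have h6 := hKF _ h1
    have h7 := hLF _ h2
    have h8 := hx.unique _ h1 (fun t d => hsupp (Sum.inl t) d) (by rw [e0, e2, h5])
    have h9 := hz.unique _ h2 (fun t d => hsupp (Sum.inr t) d) (by
      intro k
      rw [forall_ne_three]
      cases k
      · exact ⟨rfl, by rw [← e0, ← e1, h6], h5.symm⟩
      · exact ⟨rfl, h7.symm, h4.symm⟩)
    -- Both multiples have the same factor, since `x` and `z` each have one arc around the vertex
    -- `0` at the seam.
    have h10 := portArc_mul (K := L) h9 false 0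
    rw [hz.portArc_eq_one false 0 (by decide), mul_one, ← e0] at h10
    rintro (t | t) d
    · exact (h8 t d).trans (by rw [h10]; rfl)
    · exact h9 t d

/-- The matching equations force equal numbers of arcs around the vertices of the first port. -/
def IsTight (K : PortedComplex ι) (x : ι → Fin 4 ⊕ Fin 3 → ℝ) : Prop :=
  ∀ y, K.Matches y → SuppLE y x → ∀ v, v ≠ 3 → K.portArc y false v = K.portArc y false 0

/-- The matching equations force equal numbers of arcs on the two ports. -/
def IsParallel (K : PortedComplex ι) (x : ι → Fin 4 ⊕ Fin 3 → ℝ) : Prop :=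
  ∀ y, K.Matches y → SuppLE y x → ∀ v, v ≠ 3 → K.portArc y true v = K.portArc y false v

theorem IsTight.glue {K : PortedComplex ι} {L : PortedComplex κ} (hK : K.IsRegular)
    (hL : L.IsRegular) {x : ι → Fin 4 ⊕ Fin 3 → ℝ} (hx : K.IsTight x)
    (z : κ → Fin 4 ⊕ Fin 3 → ℝ) : (K.glue L).IsTight (Sum.elim x z) :=
  fun _ hy hsupp => hx _ ((matches_glue hK hL).1 hy).1 fun t d => hsupp (Sum.inl t) d

theorem IsParallel.glue_snapped {K : PortedComplex ι} (hK : K.IsRegular)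
    {x : ι → Fin 4 ⊕ Fin 3 → ℝ} (hx : K.IsParallel x) :
    (K.glue snapped).IsParallel (Sum.elim x snappedRay) := by
  intro y hy hsupp v hv
  obtain ⟨h1, h2, h3⟩ := (matches_glue hK isRegular_snapped).1 hy
  exact (portArc_snapped_eq (fun t d => hsupp (Sum.inr t) d) v hv).trans
    ((h3 v hv).symm.trans (hx _ h1 (fun t d => hsupp (Sum.inl t) d) v hv))

/-- Closing the ring identifies the counts on the last port with those on the first, where tightness
makes them equal. This supplies the hypothesis under which a ray is unique. -/
theorem IsRay.close_unique {K : PortedComplex ι} (hK : K.IsRegular)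
    {x : ι → Fin 4 ⊕ Fin 3 → ℝ} (hx : K.IsRay x) (ht : K.IsTight x)
    {y : ι → Fin 4 ⊕ Fin 3 → ℝ} (hy : K.close.Matches y) (hsupp : SuppLE y x) :
    ∃ w : ℝ, ∀ t d, y t d = w * x t d := by
  obtain ⟨h1, h2⟩ := (matches_close hK).1 hy
  exact ⟨_, hx.unique y h1 hsupp (by
    rw [h2 0 (by decide), h2 2 (by decide), ht y h1 hsupp 2 (by decide)])⟩

theorem IsUnitSurface.matches_close {K : PortedComplex ι} (hK : K.IsRegular)
    {x : ι → Fin 4 ⊕ Fin 3 → ℝ} (hx : K.IsUnitSurface x) : K.close.Matches x :=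
  (PortedComplex.matches_close hK).2 ⟨hx.isMatching, fun v hv =>
    (hx.portArc_eq_one true v hv).trans (hx.portArc_eq_one false v hv).symm⟩

/-! ### The seventeen surfaces of a block -/

theorem block_matching {y : Fin 4 → Fin 4 ⊕ Fin 3 → ℝ} (h : block.Matches y) :
    (y 0 (Sum.inl 0) = y 0 (Sum.inl 3) ∧ y 0 (Sum.inr 0) = y 0 (Sum.inr 1)) ∧
    (y 2 (Sum.inl 1) = y 2 (Sum.inl 3) ∧ y 2 (Sum.inr 0) = y 2 (Sum.inr 2)) ∧
    (y 3 (Sum.inl 0) = y 3 (Sum.inl 1) ∧ y 3 (Sum.inr 1) = y 3 (Sum.inr 2)) ∧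
    (arc (y 0) 1 0 = arc (y 1) 1 0 ∧ arc (y 0) 1 2 = arc (y 1) 1 2 ∧
      arc (y 0) 1 3 = arc (y 1) 1 3) ∧
    (arc (y 1) 0 1 = arc (y 2) 0 1 ∧ arc (y 1) 0 2 = arc (y 2) 0 2 ∧
      arc (y 1) 0 3 = arc (y 2) 0 3) ∧
    (arc (y 1) 2 0 = arc (y 3) 2 0 ∧ arc (y 1) 2 1 = arc (y 3) 2 1 ∧
      arc (y 1) 2 3 = arc (y 3) 2 3) ∧
    (arc (y 1) 3 0 = arc (y 3) 3 0 ∧ arc (y 1) 3 1 = arc (y 3) 3 1 ∧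
      arc (y 1) 3 2 = arc (y 3) 3 2) := by
  have e (t t' f v : Fin 4) (ht : block.adj t f = Sum.inl (t', 1)) (hv : v ≠ f) :
      arc (y t) f v = arc (y t') f v := by simpa using h t f t' 1 ht v hv
  have a1 := h 0 0 0 (swap 0 3) (by simp [block_adj]) 3 (by decide)
  have a2 := h 0 0 0 (swap 0 3) (by simp [block_adj]) 1 (by decide)
  have b1 := h 2 1 2 (swap 1 3) (by simp [block_adj]) 3 (by decide)
  have b2 := h 2 1 2 (swap 1 3) (by simp [block_adj]) 0 (by decide)
  have c1 := h 3 0 3 (swap 0 1) (by simp [block_adj]) 1 (by decide)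
  have c2 := h 3 0 3 (swap 0 1) (by simp [block_adj]) 2 (by decide)
  simp [arc, quadType, swap_apply_of_ne_of_ne] at a1 a2 b1 b2 c1 c2
  refine ⟨⟨a1.symm, a2⟩, ⟨b1.symm, b2⟩, ⟨c1.symm, c2⟩, ⟨?_, ?_, ?_⟩, ⟨?_, ?_, ?_⟩, ⟨?_, ?_, ?_⟩,
    ?_, ?_, ?_⟩ <;> exact e _ _ _ _ (by simp [block_adj]) (by decide)

theorem portArc_block (y : Fin 4 → Fin 4 ⊕ Fin 3 → ℝ) :
    (block.portArc y false 0 = y 0 (Sum.inl 0) + y 0 (Sum.inr 1) ∧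
      block.portArc y false 1 = y 0 (Sum.inl 1) + y 0 (Sum.inr 2) ∧
      block.portArc y false 2 = y 0 (Sum.inl 3) + y 0 (Sum.inr 0)) ∧
    block.portArc y true 0 = y 2 (Sum.inl 3) + y 2 (Sum.inr 0) ∧
      block.portArc y true 1 = y 2 (Sum.inl 1) + y 2 (Sum.inr 2) ∧
      block.portArc y true 2 = y 2 (Sum.inl 0) + y 2 (Sum.inr 1) := by
  simp [portArc, block_port, arc, quadType, swap_apply_of_ne_of_ne]

/-- Tetrahedron `2` is folded along its faces `1` and `3`, and the vertices exchanged by this fold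
are those labelled `0` and `1` on the second port. -/
theorem isFolded_block : block.IsFolded := by
  intro y hy
  obtain ⟨-, h0, h1, -⟩ := portArc_block y
  obtain ⟨-, ⟨h2, h3⟩, -⟩ := block_matching hy
  rw [h0, h1, h2, h3]

/-- Tetrahedron `0` is folded along its faces `0` and `3`, and the vertices exchanged by this fold
are those labelled `0` and `2` on the first port. -/
theorem portArc_block_false {y : Fin 4 → Fin 4 ⊕ Fin 3 → ℝ} (hy : block.Matches y) :
    block.portArc y false 0 = block.portArc y false 2 := by
  obtain ⟨⟨h0, -, h1⟩, -⟩ := portArc_block y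
  obtain ⟨⟨h2, h3⟩, -⟩ := block_matching hy
  rw [h0, h1, h2, h3]

/-- The seventeen normal surfaces in the block that meet every edge of the ports once. The
columns are the triangles and quadrilaterals of the four tetrahedra. -/
def blockTable : Fin 17 → Fin 4 → Fin 7 → ℕ := ![
  ![![1, 0, 0, 1, 0, 0, 1], ![0, 0, 1, 1, 1, 0, 0], ![0, 1, 0, 1, 0, 1, 0], ![0, 0, 0, 0, 2, 0, 0]],
  ![![1, 0, 0, 1, 0, 0, 1], ![1, 1, 1, 1, 0, 0, 0], ![0, 1, 0, 1, 0, 1, 0], ![1, 1, 0, 0, 1, 0, 0]],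
  ![![1, 1, 1, 1, 0, 0, 0], ![0, 0, 1, 1, 1, 0, 0], ![0, 1, 0, 1, 0, 1, 0], ![0, 0, 0, 0, 2, 0, 0]],
  ![![1, 0, 0, 1, 0, 0, 1], ![0, 0, 1, 1, 1, 0, 0], ![0, 1, 0, 1, 0, 1, 0], ![0, 0, 2, 2, 0, 0, 0]],
  ![![1, 0, 0, 1, 0, 0, 1], ![1, 1, 1, 1, 0, 0, 0], ![0, 1, 0, 1, 0, 1, 0], ![1, 1, 1, 1, 0, 0, 0]],
  ![![1, 1, 1, 1, 0, 0, 0], ![1, 1, 1, 1, 0, 0, 0], ![0, 1, 0, 1, 0, 1, 0], ![1, 1, 0, 0, 1, 0, 0]],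
  ![![1, 0, 0, 1, 0, 0, 1], ![0, 0, 1, 1, 1, 0, 0], ![1, 1, 1, 1, 0, 0, 0], ![0, 0, 0, 0, 2, 0, 0]],
  ![![1, 0, 0, 1, 0, 0, 1], ![1, 1, 1, 1, 0, 0, 0], ![1, 1, 1, 1, 0, 0, 0], ![1, 1, 0, 0, 1, 0, 0]],
  ![![1, 1, 1, 1, 0, 0, 0], ![0, 0, 1, 1, 1, 0, 0], ![1, 1, 1, 1, 0, 0, 0], ![0, 0, 0, 0, 2, 0, 0]],
  ![![1, 1, 0, 1, 0, 0, 0], ![0, 0, 0, 1, 1, 0, 0], ![1, 1, 0, 1, 0, 0, 0], ![0, 0, 1, 2, 0, 0, 0]],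
  ![![1, 1, 1, 1, 0, 0, 0], ![0, 0, 1, 1, 1, 0, 0], ![0, 1, 0, 1, 0, 1, 0], ![0, 0, 2, 2, 0, 0, 0]],
  ![![1, 0, 0, 1, 0, 0, 1], ![0, 0, 1, 1, 1, 0, 0], ![1, 1, 1, 1, 0, 0, 0], ![0, 0, 2, 2, 0, 0, 0]],
  ![![1, 1, 0, 1, 0, 0, 0], ![0, 0, 0, 1, 1, 0, 0], ![1, 1, 0, 1, 0, 0, 0], ![0, 0, 0, 1, 1, 0, 0]],
  ![![1, 1, 0, 1, 0, 0, 0], ![1, 1, 0, 1, 0, 0, 0], ![1, 1, 0, 1, 0, 0, 0], ![1, 1, 0, 1, 0, 0, 0]],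
  ![![1, 1, 1, 1, 0, 0, 0], ![1, 1, 1, 1, 0, 0, 0], ![0, 1, 0, 1, 0, 1, 0], ![1, 1, 1, 1, 0, 0, 0]],
  ![![1, 0, 0, 1, 0, 0, 1], ![1, 1, 1, 1, 0, 0, 0], ![1, 1, 1, 1, 0, 0, 0], ![1, 1, 1, 1, 0, 0, 0]],
  ![![1, 1, 1, 1, 0, 0, 0], ![1, 1, 1, 1, 0, 0, 0], ![1, 1, 1, 1, 0, 0, 0], ![1, 1, 0, 0, 1, 0, 0]]]

/-- The coordinates in the table, as natural numbers. -/
def blockRayNat (c : Fin 17) (t : Fin 4) : Fin 4 ⊕ Fin 3 → ℕ :=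
  Sum.elim (fun v => blockTable c t (Fin.castAdd 3 v)) (fun i => blockTable c t (Fin.natAdd 4 i))

/-- The seventeen normal surfaces in the block that meet every edge of the ports once. -/
def blockRay (c : Fin 17) (t : Fin 4) (d : Fin 4 ⊕ Fin 3) : ℝ := blockRayNat c t d

theorem blockRay_injective : Function.Injective blockRay := by
  intro c c' h
  have h : ∀ t d, blockRayNat c t d = blockRayNat c' t d := fun t d =>
    Nat.cast_injective (R := ℝ) (congrFun (congrFun h t) d)
  clear * - h
  revert c c'
  decide +kernel

theorem quad_blockRay (c : Fin 17) (t : Fin 4) (i j : Fin 3)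
    (hi : blockRay c t (Sum.inr i) ≠ 0) (hj : blockRay c t (Sum.inr j) ≠ 0) : i = j := by
  have hi := Nat.cast_ne_zero.1 hi
  have hj := Nat.cast_ne_zero.1 hj
  clear * - hi hj
  revert c t i j
  decide +kernel

theorem matches_blockRay (c : Fin 17) : block.Matches (blockRay c) := by
  intro t f t' g h v hv
  -- At a port the default `(t, 1)` glues the face to itself by the identity, so the equation there
  -- is trivial and the statement can be decided uniformly.
  have key : ∀ c t f v, v ≠ f → ∀ x, x = Sum.elim id (fun _ => (t, 1)) (block.adj t f) →
      arc (blockRayNat c t) f v = arc (blockRayNat c x.1) (x.2 f) (x.2 v) := by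
    simp only [forall_eq]
    decide +kernel
  have := key c t f v hv (t', g) (by rw [h]; rfl)
  simp only [arc, blockRay] at this ⊢
  exact_mod_cast this

theorem portArc_blockRay (c : Fin 17) (k : Bool) (v : Fin 4) (hv : v ≠ 3) :
    block.portArc (blockRay c) k v = 1 := by
  have key : ∀ c k v, v ≠ 3 → block.portArc (blockRayNat c) k v = 1 := by
    intro c k v hv
    rw [portArc, block_port]
    revert c k v
    decide +kernel
  have := key c k v hv
  simp only [portArc, arc, blockRay] at this ⊢
  exact_mod_cast this

-- For each surface the zero coordinates reduce the matching equations to a small linear system.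
-- With balanced ports its solutions are the multiples of the surface; in particular `w = w'` is a
-- consequence and need not be assumed.
set_option maxHeartbeats 4000000 in
theorem blockRay_unique (c : Fin 17) {y : Fin 4 → Fin 4 ⊕ Fin 3 → ℝ} (hy : block.Matches y)
    (hsupp : SuppLE y (blockRay c)) {w : ℝ} (h : ∀ v, v ≠ 3 → block.portArc y false v = w)
    {w' : ℝ} (h' : ∀ v, v ≠ 3 → block.portArc y true v = w') (t : Fin 4) (d : Fin 4 ⊕ Fin 3) :
    y t d = w' * blockRay c t d := by
  have hz : ∀ t d, blockRayNat c t d = 0 → y t d = 0 := fun t d hd => hsupp t d (by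
    simp [blockRay, hd])
  obtain ⟨⟨p1, p2, p3⟩, q1, q2, q3⟩ := portArc_block y
  rw [h _ (by decide)] at p1 p2 p3
  rw [h' _ (by decide)] at q1 q2 q3
  obtain ⟨⟨a1, a2⟩, ⟨b1, b2⟩, ⟨c1, c2⟩, ⟨d1, d2, d3⟩, ⟨e1, e2, e3⟩, ⟨f1, f2, f3⟩, g1, g2, g3⟩ :=
    block_matching hy
  clear hy hsupp h h'
  have hz1 : ∀ t v, blockTable c t (Fin.castAdd 3 v) = 0 → y t (Sum.inl v) = 0 := fun t v =>
    hz t (Sum.inl v)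
  have hz2 : ∀ t v, blockTable c t (Fin.natAdd 4 v) = 0 → y t (Sum.inr v) = 0 := fun t v =>
    hz t (Sum.inr v)
  clear hz
  simp only [arc, quadType] at d1 d2 d3 e1 e2 e3 f1 f2 f3 g1 g2 g3
  simp only [Matrix.cons_val] at d1 d2 d3 e1 e2 e3 f1 f2 f3 g1 g2 g3
  suffices hs : (∀ t v, y t (Sum.inl v) = w' * blockTable c t (Fin.castAdd 3 v)) ∧
      ∀ t v, y t (Sum.inr v) = w' * blockTable c t (Fin.natAdd 4 v) by
    rcases d with d | d
    exacts [hs.1 t d, hs.2 t d]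
  fin_cases c <;> simp [Fin.forall_fin_succ, blockTable] at hz1 hz2 ⊢
  all_goals
    simp only [hz1, hz2, add_zero, zero_add, true_and, and_true] at p1 p2 p3 q1 q2 q3 d1 d2 d3 ⊢
    simp only [hz1, hz2, add_zero, zero_add] at e1 e2 e3 f1 f2 f3 g1 g2 g3
    clear hz1 hz2
    repeat' apply And.intro
    all_goals linarith

theorem isCellRay_blockRay (c : Fin 17) : block.IsCellRay (blockRay c) where
  nonneg _ _ := Nat.cast_nonneg _
  quad := quad_blockRay c
  isMatching := matches_blockRay c
  portArc_eq_one := portArc_blockRay c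
  unique _ hy hsupp h := blockRay_unique c hy hsupp (h false) (h true)
  back _ hy _ _ := portArc_block_false hy

/-- At the far end of `K` its own fold balances `0` and `1`, and the fold of the block balances `0`
and `2`. Parallelism carries both equalities back to the first port. -/
theorem IsParallel.isTight_glue_block {ι : Type} {K : PortedComplex ι} (hK : K.IsRegular)
    (hF : K.IsFolded) {x : ι → Fin 4 ⊕ Fin 3 → ℝ} (hx : K.IsParallel x)
    (z : Fin 4 → Fin 4 ⊕ Fin 3 → ℝ) : (K.glue block).IsTight (Sum.elim x z) := by
  intro y hy hsupp
  obtain ⟨h1, h2, h3⟩ := (matches_glue hK isRegular_block).1 hy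
  obtain ⟨e0, -, e2⟩ := forall_ne_three.1 h3
  obtain ⟨p0, p1, p2⟩ := forall_ne_three.1 (hx _ h1 fun t d => hsupp (Sum.inl t) d)
  rw [forall_ne_three]
  refine ⟨rfl, ?_, ?_⟩
  · exact p1.symm.trans ((hF _ h1).symm.trans p0)
  · exact p2.symm.trans ((e2.trans ((portArc_block_false h2).symm.trans e0.symm)).trans p0)

end PortedComplex

/-! ### Counting vertices of the projective solution space -/

/-- A point of the projective solution space that is determined by its support up to a factor is a
vertex. -/
theorem mem_admissibleVertices_of_unique {n : ℕ} {T : Gluing n} {x : DiscType n → ℝ}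
    (hx : x ∈ projectiveSolutionSpace T) (hq : QuadConstraints x)
    (h : ∀ y, Matching T y → (∀ d, x d = 0 → y d = 0) → ∃ w : ℝ, ∀ d, y d = w * x d) :
    x ∈ admissibleVertices T := by
  refine ⟨⟨hx, ?_⟩, hq⟩
  rintro y ⟨hy0, hym, hys⟩ z ⟨hz0, -, -⟩ ⟨a, b, ha, hb, -, hxyz⟩
  obtain ⟨w, hw⟩ := h y hym fun d hd => by
    have h1 := congrFun hxyz d
    simp only [Pi.add_apply, Pi.smul_apply, smul_eq_mul] at h1
    have h2 := mul_nonneg hb.le (hz0 d)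
    have h3 : a * y d ≤ 0 := by linarith
    have h4 : y d ≤ 0 := nonpos_of_mul_nonpos_right h3 ha
    exact le_antisymm h4 (hy0 d)
  have h1 : w = 1 := by
    rw [← hys]
    simp only [hw]
    rw [← Finset.mul_sum, hx.2.2, mul_one]
  funext d
  rw [hw, h1, one_mul]

namespace PortedComplex

variable {ι κ : Type}

/-- There is a complex with `n` tetrahedra, homeomorphic to the snapped tetrahedron relative to
the ports, that has `m` rays with the property `P`. -/
def HasRays (P : ∀ ι : Type, PortedComplex ι → (ι → Fin 4 ⊕ Fin 3 → ℝ) → Prop) (n m : ℕ) : Prop :=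
  ∃ (ι : Type) (_ : Fintype ι) (_ : TopologicalSpace ι) (_ : DiscreteTopology ι)
    (K : PortedComplex ι) (A : Finset (ι → Fin 4 ⊕ Fin 3 → ℝ)), K.IsRegular ∧ K.IsFolded ∧
    PortHomeo K snapped ∧ Fintype.card ι = n ∧ A.card = m ∧ ∀ x ∈ A, K.IsRay x ∧ P ι K x

/-- The choices in `K` and in `L` are independent, so the numbers of rays multiply. Topologically,
`K` may be replaced by `snapped` before `L` is attached. -/
theorem HasRays.glue [Fintype κ] [TopologicalSpace κ] [DiscreteTopology κ]
    {P Q : ∀ ι : Type, PortedComplex ι → (ι → Fin 4 ⊕ Fin 3 → ℝ) → Prop} {n m : ℕ}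
    (h : HasRays P n m) {L : PortedComplex κ} (hL : L.IsRegular) (hF : L.IsFolded)
    (hhom : PortHomeo (snapped.glue L) snapped) {γ : Type} [Fintype γ]
    {z : γ → κ → Fin 4 ⊕ Fin 3 → ℝ} (hinj : Function.Injective z) (hz : ∀ c, L.IsCellRay (z c))
    (hPQ : ∀ (ι : Type) (K : PortedComplex ι) (x : ι → Fin 4 ⊕ Fin 3 → ℝ) (c : γ),
      K.IsRegular → K.IsFolded → P ι K x → Q (ι ⊕ κ) (K.glue L) (Sum.elim x (z c))) :
    HasRays Q (n + Fintype.card κ) (m * Fintype.card γ) := by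
  classical
  obtain ⟨ι, _, _, _, K, A, hK, hKF, hKhom, rfl, rfl, hA⟩ := h
  refine ⟨ι ⊕ κ, inferInstance, inferInstance, inferInstance, K.glue L,
    (A ×ˢ Finset.univ).image fun p : (ι → Fin 4 ⊕ Fin 3 → ℝ) × γ => Sum.elim p.1 (z p.2),
    hK.glue hL, hF.glue hK hL,
    (hKhom.glue L hK.portLaw isRegular_snapped.portLaw hL.portLaw).trans hhom,
    Fintype.card_sum, ?_, ?_⟩
  · rw [Finset.card_image_of_injective, Finset.card_product, Finset.card_univ]
    rintro ⟨x, c⟩ ⟨x', c'⟩ hxx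
    dsimp only at hxx
    rw [Sum.elim_eq_iff] at hxx
    exact Prod.ext hxx.1 (hinj hxx.2)
  · intro y hy
    obtain ⟨⟨x, c⟩, hx, rfl⟩ := Finset.mem_image.1 hy
    obtain ⟨hx, hP⟩ := hA x (Finset.mem_product.1 hx).1
    exact ⟨hx.glue hK hL hKF hF (hz c), hPQ ι K x c hK hKF hP⟩

/-- A chain of snapped balls contributes only one ray. It is there to reach every size and to begin
the ring with a parallel part. -/
theorem hasRays_chain (r : ℕ) : HasRays (fun _ K => K.IsParallel) (r + 1) 1 := by
  induction r with
  | zero =>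
    exact ⟨Fin 1, inferInstance, inferInstance, inferInstance, snapped, {snappedRay},
      isRegular_snapped, isFolded_snapped, PortHomeo.refl _, rfl, rfl, fun x hx => by
        rw [Finset.mem_singleton.1 hx]
        exact ⟨isRay_snappedRay, fun y _ hy v hv => portArc_snapped_eq hy v hv⟩⟩
  | succ r ih =>
    exact ih.glue (γ := Unit) isRegular_snapped isFolded_snapped snapped_glue_snapped
      (z := fun _ => snappedRay) (fun _ _ _ => rfl) (fun _ => isCellRay_snappedRay)
      fun _ _ _ _ hK _ hx => hx.glue_snapped hK

/-- The first block turns parallelism of the chain into tightness. Later blocks leave the first port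
untouched and so keep it tight. -/
theorem hasRays_blocks (r k : ℕ) :
    HasRays (fun _ K => K.IsTight) (r + 1 + 4 * (k + 1)) (17 ^ (k + 1)) := by
  induction k with
  | zero =>
    simpa using (hasRays_chain r).glue isRegular_block isFolded_block snapped_glue_block
      blockRay_injective isCellRay_blockRay (Q := fun _ K => K.IsTight)
      fun _ _ _ _ hK hF hx => hx.isTight_glue_block hK hF _
  | succ k ih =>
    exact ih.glue isRegular_block isFolded_block snapped_glue_block
      blockRay_injective isCellRay_blockRay
      fun _ _ _ _ hK hF hx => hx.glue hK isRegular_block _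

theorem matching_toGluing {n : ℕ} {K : PortedComplex ι} (hK : K.IsRegular) (e : ι ≃ Fin n)
    (y : DiscType n → ℝ) :
    Matching (toGluing hK e) y ↔ K.close.Matches fun t d => y (e t, d) := by
  constructor
  · intro h t f t' g hadj v hv
    rw [close_adj] at hadj
    have hadj := Sum.inl_injective hadj
    have := h (e t) f v hv
    simpa [toGluing, hadj, arcs, arc] using this
  · intro h t f v hv
    have := h (e.symm t) f (K.closeAdj (e.symm t) f).1 (K.closeAdj (e.symm t) f).2
      (close_adj K _ _) v hv
    simpa [toGluing, arcs, arc] using this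

theorem IsUnitSurface.sum_pos [Fintype ι] {K : PortedComplex ι} {x : ι → Fin 4 ⊕ Fin 3 → ℝ}
    (hx : K.IsUnitSurface x) : 0 < ∑ t, ∑ d, x t d := by
  have h0 : ∀ t, 0 ≤ ∑ d, x t d := fun t => Finset.sum_nonneg fun d _ => hx.nonneg t d
  refine (Finset.sum_nonneg fun t _ => h0 t).lt_of_ne fun h => ?_
  rw [eq_comm, Finset.sum_eq_zero_iff_of_nonneg fun t _ => h0 t] at h
  have h1 : ∀ t d, x t d = 0 := fun t d =>
    (Finset.sum_eq_zero_iff_of_nonneg fun d _ => hx.nonneg t d).1 (h t (Finset.mem_univ t)) d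
      (Finset.mem_univ d)
  have := hx.portArc_eq_one true 0 (by decide)
  simp [portArc, arc, h1] at this

/-- The point of the projective solution space given by a normal surface. -/
noncomputable def normalize [Fintype ι] {n : ℕ} (e : ι ≃ Fin n) (x : ι → Fin 4 ⊕ Fin 3 → ℝ) :
    DiscType n → ℝ :=
  fun d => (∑ t, ∑ d, x t d)⁻¹ * x (e.symm d.1) d.2

/-- Surfaces with the same normalization are proportional, and the factor is `1` because both have
one arc around a port vertex. -/
theorem normalize_injOn [Fintype ι] {n : ℕ} (e : ι ≃ Fin n) {K : PortedComplex ι}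
    {x x' : ι → Fin 4 ⊕ Fin 3 → ℝ} (hx : K.IsUnitSurface x) (hx' : K.IsUnitSurface x')
    (h : normalize e x = normalize e x') : x = x' := by
  have hs := hx.sum_pos.ne'
  have h1 : ∀ t d, x t d = (∑ t, ∑ d, x t d) * (∑ t, ∑ d, x' t d)⁻¹ * x' t d := by
    intro t d
    have := congrFun h (e t, d)
    simp only [normalize, e.symm_apply_apply] at this
    rw [mul_assoc, ← this]
    field_simp
  have h2 := portArc_mul (K := K) h1 true 0
  rw [hx.portArc_eq_one true 0 (by decide), hx'.portArc_eq_one true 0 (by decide), mul_one] at h2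
  funext t d
  rw [h1, ← h2, one_mul]

theorem normalize_mem [Fintype ι] {n : ℕ} {K : PortedComplex ι} (hK : K.IsRegular) (e : ι ≃ Fin n)
    {x : ι → Fin 4 ⊕ Fin 3 → ℝ} (hx : K.IsRay x) (ht : K.IsTight x) :
    normalize e x ∈ admissibleVertices (toGluing hK e) := by
  have hs := hx.sum_pos
  refine mem_admissibleVertices_of_unique ⟨fun d => ?_, ?_, ?_⟩ ?_ ?_
  · exact mul_nonneg (inv_nonneg.2 hs.le) (hx.nonneg _ _)
  · rw [matching_toGluing]
    intro t f t' g hadj v hv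
    have := hx.matches_close hK t f t' g hadj v hv
    simp only [arc, normalize, e.symm_apply_apply, ← mul_add] at this ⊢
    rw [this]
  · rw [Fintype.sum_prod_type, ← e.sum_comp]
    simp only [normalize, e.symm_apply_apply, ← Finset.mul_sum]
    exact inv_mul_cancel₀ hs.ne'
  · intro t i j hi hj
    exact hx.quad (e.symm t) i j (right_ne_zero_of_mul hi) (right_ne_zero_of_mul hj)
  · intro y hy hsupp
    obtain ⟨w, hw⟩ := hx.close_unique hK ht ((matching_toGluing hK e y).1 hy) fun t d hd =>
      hsupp (e t, d) (by simp [normalize, hd])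
    refine ⟨w * ∑ t, ∑ d, x t d, fun d => ?_⟩
    have := hw (e.symm d.1) d.2
    simp only [e.apply_symm_apply] at this
    rw [this, normalize]
    field_simp

theorem HasRays.exists_gluing {n m : ℕ} (h : HasRays (fun _ K => K.IsTight) n m) :
    ∃ T : Gluing n, T.IsClosedThreeManifold ∧ m ≤ sigma T := by
  classical
  obtain ⟨ι, _, _, _, K, A, hK, -, hhom, hn, rfl, hA⟩ := h
  let e := Fintype.equivFinOfCardEq hn
  refine ⟨toGluing hK e, isClosedThreeManifold_toGluing hK hhom e, ?_⟩
  rw [sigma, ← Finset.card_image_of_injOn (f := normalize e) (s := A) fun x hx x' hx' =>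
    normalize_injOn e (hA x hx).1.toIsUnitSurface (hA x' hx').1.toIsUnitSurface,
    ← Set.ncard_coe_finset]
  refine Set.ncard_le_ncard ?_ (admissibleVertices_finite _)
  intro y hy
  obtain ⟨x, hx, rfl⟩ := Finset.mem_image.1 hy
  exact normalize_mem hK e (hA x hx).1 (hA x hx).2

end PortedComplex

/-- The ring needs one snapped ball and one block. For `n ≥ 5` take `(n - 1) / 4` blocks; between
one and four tetrahedra remain as snapped balls. -/
theorem exists_gluing_pow_le_sigma {n : ℕ} (hn : 5 ≤ n) :
    ∃ T : Gluing n, T.IsClosedThreeManifold ∧ 17 ^ ((n - 1) / 4) ≤ sigma T := by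
  obtain ⟨k, hk⟩ : ∃ k, (n - 1) / 4 = k + 1 := ⟨(n - 1) / 4 - 1, by omega⟩
  obtain ⟨r, hr⟩ : ∃ r, n = r + 1 + 4 * (k + 1) := ⟨n - 1 - 4 * (k + 1), by omega⟩
  rw [hk, hr]
  exact (PortedComplex.hasRays_blocks r k).exists_gluing

end NormalSurface

/-! ### The asymptotic bounds -/

theorem mainTheorem5 :
    (∀ f : ℕ → ℝ,
      (∀ (n : ℕ) (T : NormalSurface.Gluing n), T.IsClosedThreeManifold →
        (NormalSurface.sigma T : ℝ) ≤ f n) →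
      ∃ c : ℝ, 0 < c ∧ ∃ N : ℕ, ∀ n : ℕ, N ≤ n → c * (17 : ℝ) ^ ((n : ℝ) / 4) ≤ f n) ∧
    |(17 : ℝ) ^ ((1 : ℝ) / 4) - 2.03| < 0.005 ∧
    ¬ ∃ (C : ℝ) (N : ℕ), ∀ n : ℕ, N ≤ n →
      ∀ T : NormalSurface.Gluing n, T.IsClosedThreeManifold →
        (NormalSurface.sigma T : ℝ) ≤ C * 2 ^ n := by
  -- The number of blocks `⌊(n - 1) / 4⌋` is at least `n / 4 - 1`, so at most one factor `17` is
  -- lost.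
  refine ⟨fun f hf => ⟨17⁻¹, by norm_num, 5, fun n hn => ?_⟩, ?_, ?_⟩
  · obtain ⟨T, hT, hs⟩ := NormalSurface.exists_gluing_pow_le_sigma hn
    refine le_trans ?_ ((Nat.cast_le (α := ℝ)).2 hs |>.trans (hf n T hT))
    have h1 : (n : ℝ) ≤ 4 * ((n - 1) / 4 + 1 : ℕ) := by
      exact_mod_cast (by omega : n ≤ 4 * ((n - 1) / 4 + 1))
    have h2 : (17 : ℝ) ^ ((n : ℝ) / 4) ≤ 17 ^ (((n - 1) / 4 + 1 : ℕ) : ℝ) :=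
      Real.rpow_le_rpow_of_exponent_le (by norm_num) (by linarith)
    rw [Real.rpow_natCast, pow_succ] at h2
    push_cast
    linarith
  · have h0 : (0 : ℝ) ≤ 17 ^ ((1 : ℝ) / 4) := by positivity
    have h4 : ((17 : ℝ) ^ ((1 : ℝ) / 4)) ^ 4 = 17 := by
      rw [← Real.rpow_natCast, ← Real.rpow_mul (by norm_num)]
      norm_num
    rw [abs_lt]
    constructor
    · have : (2.025 : ℝ) < 17 ^ ((1 : ℝ) / 4) :=
        lt_of_pow_lt_pow_left₀ 4 h0 (by rw [h4]; norm_num)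
      linarith
    · have : (17 : ℝ) ^ ((1 : ℝ) / 4) < 2.035 :=
        lt_of_pow_lt_pow_left₀ 4 (by norm_num) (by rw [h4]; norm_num)
      linarith
  · rintro ⟨C, N, h⟩
    -- For sizes `n = 4m + 1` a bound `C * 2 ^ n` would give `17 ^ m ≤ 2C * 16 ^ m`. This fails for
    -- `m = k + N + 1`, which also makes `n` at least `N`.
    obtain ⟨k, hk⟩ := pow_unbounded_of_one_lt (2 * C) (by norm_num : (1 : ℝ) < 17 / 16)
    have hk' : 2 * C < (17 / 16) ^ (k + N + 1) :=
      hk.trans_le (pow_le_pow_right₀ (by norm_num) (by omega))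
    obtain ⟨T, hT, hs⟩ :=
      NormalSurface.exists_gluing_pow_le_sigma (n := 4 * (k + N + 1) + 1) (by omega)
    have h1 := ((Nat.cast_le (α := ℝ)).2 hs).trans (h _ (by omega) T hT)
    rw [Nat.add_sub_cancel, Nat.mul_div_cancel_left _ (by norm_num), pow_succ (2 : ℝ), pow_mul] at h1
    push_cast at h1
    rw [div_pow, lt_div_iff₀ (by positivity)] at hk'
    norm_num at h1
    linarith
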